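/- Let $d\ge 1$ and let $\mathbb H_d$ be the space of symmetric $\tau\in M_d(\mathbb C)$ with positive definite imaginary part. For $\tau\in\mathbb H_d$ put $$A_\tau=M_{d,1}(\mathbb C)/(1_d\ \ {-\tau})M_{2d,1}(\mathbb Z),\qquad B_\tau=M_{1,d}(\mathbb C)/2\pi i\,M_{1,2d}(\mathbb Z)\begin{pmatrix}\tau\\ 1_d\end{pmatrix}.$$ For $x=(x_1,x_2)\in M_{1,2d}(\mathbb R)$ let $\overline x\in B_\tau$ be the class of $2\pi i(x_1\tau+x_2)$. **The Poincaré torsor.** Let $M=\mathbb Z(1)\oplus\mathbb Z^{2d}\oplus\mathbb Z$ with basis $2\pi i e_0,e_1,\dots,e_{2d+1}$ and weight filtration $W_{-2}M=\mathbb Z(1)$, $W_{-1}M=\mathbb Z(1)\oplus\mathbb Z^{2d}$, $W_0M=M$. Let $D_\tau$ be the set of mixed Hodge structures on $M$ of type $\{(-1,-1),(-1,0),(0,-1),(0,0)\}$ inducing $M_\tau^{0,-1}=\binom{\tau}{1_d}\mathbb C^d$ on $\mathrm{Gr}^W_{-1}$. They are the subspaces $$F^0=\begin{pmatrix}u&w\\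 \tau&v\\ 1_d&0\\ 0&1\end{pmatrix}\mathbb C^{d+1},\qquad (u,v,w)\in M_{1,d}(\mathbb C)\times M_{d,1}(\mathbb C)\times\mathbb C;$$ let $\tilde\tau$ be the one with $u=v=w=0$, and give $D_\tau$ the complex structure defined by $(u,v,w)$. Let $P^u(\mathbb R)U(\mathbb C)$ be the group of matrices $\left(\begin{smallmatrix}1&x&z\\0&1_{2d}&y\\0&0&1\end{smallmatrix}\right)$ with $x\in M_{1,2d}(\mathbb R)$, $y\in M_{2d,1}(\mathbb R)$, $z\in\mathbb C$, acting on $M_{\mathbb C}$ in the basis $2\pi ie_0,e_1,\dots,e_{2d+1}$, and hence on $D_\tau$; let $P^u(\mathbb Z)$ be its subgroup of integral matrices. The quotient $\mathcal P_\tau=P^u(\mathbb Z)\backslash D_\tau$, with the projections to $B_\tau$ and $A_\tau$ given by $u$ and $v$, is the Poincaré torsor on $A_\tau\times B_\tau$. For $b\in B_\tau$ with representative $u$, the fibre $E_{\tau,b}$ of $\mathcal P_\tau$ over $b$ is the extension of $A_\tau$ by $\mathbb C^\times=\mathbb C/2\pi i\mathbb Z$ corresponding to $b$, namely the cokernel of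 $$\mathbb Z(1)\oplus M_{2d,1}(\mathbb Z)\to\mathbb C\oplus M_{d,1}(\mathbb C),\qquad (2\pi ik,m)\mapsto(2\pi ik-um_2,\ m_1-\tau m_2).$$ Its group law comes from adding $(v,w)$ at fixed $u$. The zeros of the groups $E_{\tau,b}$ form the unit section of $\mathcal P_\tau$ over $B_\tau$. **The Ribet section.** Fix $\tau_0\in\mathbb H_d$ and a morphism of complex tori $f:B_{\tau_0}\to A_{\tau_0}$ with dual $f^\vee:B_{\tau_0}\to A_{\tau_0}$ (that is, for each $b$ there is a morphism of extensions over $f$, identity on $\mathbb C^\times$, from the extension of $B_{\tau_0}$ by $\mathbb C^\times$ given by the fibre of $\mathcal P_{\tau_0}$ over $f^\vee(b)\in A_{\tau_0}$ to $E_{\tau_0,b}$). Put $\alpha=f-f^\vee$, and let $f_{\mathbb Z},\alpha_{\mathbb Z}\in M_{2d}(\mathbb Z)$ be the matrices of the induced maps $2\pi i\,n\mapsto f_{\mathbb Z}n^t$, $2\pi i\,n\mapsto\alpha_{\mathbb Z}n^t$ from $M_{1,2d}(\mathbb Z(1))$ to $M_{2d,1}(\mathbb Z)$. Let $\Psi$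 be the form $2\pi i\,x^t\left(\begin{smallmatrix}0&-1_d\\1_d&0\end{smallmatrix}\right)y$, let $G_\alpha(\mathbb R)^+$ be the identity component of the group of all $(g,\mu)\in\mathrm{GSp}(\Psi)(\mathbb R)$ with $g\alpha_{\mathbb Z}=\mu\,\alpha_{\mathbb Z}\,(g^{-1})^t$, and let $\mathbb H_{d,\alpha}=G_\alpha(\mathbb R)^+\cdot\tau_0\subset\mathbb H_d$, where $g\tau=\tau'$ means $gM_\tau^{0,-1}=M_{\tau'}^{0,-1}$. **Proposition.** Let $\tau\in\mathbb H_{d,\alpha}$. 1. The map $p\mapsto p\cdot\tilde\tau$ is a bijection $P^u(\mathbb R)U(\mathbb C)\to D_\tau$ and induces a bijection $P^u(\mathbb Z)\backslash P^u(\mathbb R)U(\mathbb C)\to\mathcal P_\tau$. For each $x\in M_{1,2d}(\mathbb R)$ the latter sends the class of $p_x=\left(\begin{smallmatrix}1&x&0\\0&1_{2d}&0\\0&0&1\end{smallmatrix}\right)$ to the value at $\overline x$ of the unit section, and the image of the set of all these classes is the unit section of $\mathcal P_\tau$ over $B_\tau$. 2. The matrix $\alpha_{\mathbb Z}$ defines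 a morphism $\alpha:B_\tau\to A_\tau$, and there is exactly one holomorphic section $r_f$ over $B_\tau$ of the restriction of $\mathcal P_\tau$ to the graph of $\alpha$ whose value at the origin is $1$, i.e. the zero of $E_{\tau,0}$. 3. For every $x\in M_{1,2d}(\mathbb R)$ there is an isomorphism of real Lie groups $$(\mathbb C/2\pi i\mathbb Z)\times\bigl(M_{2d,1}(\mathbb R)/M_{2d,1}(\mathbb Z)\bigr)\ \xrightarrow{\ \sim\ }\ E_{\tau,\overline x},$$ lifting to an isomorphism of real vector spaces between universal covers, which sends the class of $(2\pi iz,y)$ to the class of $\left(\begin{smallmatrix}1&0&z\\0&1_{2d}&y\\0&0&1\end{smallmatrix}\right)p_x\cdot\tilde\tau$ and sends the class of $$(2\pi i\,x f_{\mathbb Z}x^t,\ \alpha_{\mathbb Z}x^t)$$ to $r_f(\overline x)$. 4. If $\overline x$ has finite order $n\ge1$ in $B_\tau$, then $n^2\,r_f(\overline x)=0$ in $E_{\tau,\overline x}$. -/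

import Mathlib

open Matrix Topology

namespace RibetMSV

noncomputable section

/-! Rows and columns of length `d` are functions on `Fin d`; rows and columns of length `2d` are
functions on `Idx d`, whose `inl` half is the first block and whose `inr` half is the second. -/

/-- Index set of the standard basis `e_1, …, e_{2d}`. -/
abbrev Idx (d : ℕ) := Fin d ⊕ Fin d

/-- The Siegel half space: symmetric complex matrices with positive definite imaginary part. -/
def SiegelSpace (d : ℕ) : Type :=
  {τ : Matrix (Fin d) (Fin d) ℂ // τ.IsSymm ∧ (τ.map Complex.im).PosDef}

/-- The subspace `M_τ^{0,-1} = {(τ s, s)}` of `ℂ^{2d}`. -/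
def hodgeSub {d : ℕ} (τ : SiegelSpace d) : Submodule ℂ (Idx d → ℂ) where
  carrier := {b | ∃ s : Fin d → ℂ, b = Sum.elim (τ.1 *ᵥ s) s}
  zero_mem' := ⟨0, by ext (i | i) <;> simp⟩
  add_mem' := by
    rintro _ _ ⟨s, rfl⟩ ⟨t, rfl⟩
    exact ⟨s + t, by ext (i | i) <;> simp [mulVec_add]⟩
  smul_mem' := by
    rintro c _ ⟨s, rfl⟩
    exact ⟨c • s, by ext (i | i) <;> simp [mulVec_smul]⟩

/-! ### The tori `A_τ` and `B_τ` and their morphisms -/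

/-- The integral vectors `ℤ^{2d}` in `ℝ^{2d}`. -/
def castHom (d : ℕ) : (Idx d → ℤ) →+ (Idx d → ℝ) where
  toFun n := fun i => (n i : ℝ)
  map_zero' := by ext; simp
  map_add' m n := by ext; simp

/-- The subgroup `ℤ^{2d}` of `ℝ^{2d}`. -/
def intLattice (d : ℕ) : AddSubgroup (Idx d → ℝ) := (castHom d).range

/-- `y = (y₁, y₂) ↦ (1_d  -τ) y = y₁ - τ y₂` on real columns. -/
def colMap {d : ℕ} (τ : SiegelSpace d) : (Idx d → ℝ) →+ (Fin d → ℂ) where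
  toFun y := (fun i => (y (Sum.inl i) : ℂ)) - τ.1 *ᵥ (fun i => (y (Sum.inr i) : ℂ))
  map_zero' := by ext; simp [mulVec, dotProduct]
  map_add' y y' := by
    ext i
    simp only [mulVec, dotProduct, Pi.add_apply, Pi.sub_apply, Complex.ofReal_add, mul_add,
      Finset.sum_add_distrib]
    ring

/-- `x = (x₁, x₂) ↦ 2πi (x₁ τ + x₂)` on real rows. -/
def rowMap {d : ℕ} (τ : SiegelSpace d) : (Idx d → ℝ) →+ (Fin d → ℂ) where
  toFun x := (2 * Real.pi * Complex.I : ℂ) •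
    ((fun i => (x (Sum.inl i) : ℂ)) ᵥ* τ.1 + (fun i => (x (Sum.inr i) : ℂ)))
  map_zero' := by ext; simp [vecMul, dotProduct]
  map_add' x x' := by
    ext i
    simp only [vecMul, dotProduct, Pi.add_apply, Pi.smul_apply, Complex.ofReal_add, add_mul,
      Finset.sum_add_distrib, smul_eq_mul]
    ring

/-- The lattice `(1_d  -τ) ℤ^{2d}` of `A_τ`. -/
def latA {d : ℕ} (τ : SiegelSpace d) : AddSubgroup (Fin d → ℂ) := (intLattice d).map (colMap τ)

/-- The lattice `2πi ℤ^{2d} (τ; 1_d)` of `B_τ`. -/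
def latB {d : ℕ} (τ : SiegelSpace d) : AddSubgroup (Fin d → ℂ) := (intLattice d).map (rowMap τ)

/-- `A_τ = M_{d,1}(ℂ) / (1_d  -τ) M_{2d,1}(ℤ)`. -/
abbrev TorusA {d : ℕ} (τ : SiegelSpace d) := (Fin d → ℂ) ⧸ latA τ

/-- `B_τ = M_{1,d}(ℂ) / M_{1,2d}(ℤ(1)) (τ; 1_d)`, the dual torus of `A_τ`. -/
abbrev TorusB {d : ℕ} (τ : SiegelSpace d) := (Fin d → ℂ) ⧸ latB τ

/-- The image in `B_τ` of a real row `x = (x₁, x₂)`, that is, the class of `2πi (x₁ τ + x₂)`. -/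
def toB {d : ℕ} (τ : SiegelSpace d) (x : Idx d → ℝ) : TorusB τ :=
  QuotientAddGroup.mk (rowMap τ x)

/-- A morphism of complex tori `B_τ → A_τ`: the complex linear map `u ↦ matC · uᵗ` together with the
map `2πi n ↦ matZ · nᵗ` that it induces on the lattices. -/
structure TorusHom {d : ℕ} (τ : SiegelSpace d) where
  matC : Matrix (Fin d) (Fin d) ℂ
  matZ : Matrix (Idx d) (Idx d) ℤ
  comm : ∀ n : Idx d → ℤ, matC *ᵥ rowMap τ (castHom d n) = colMap τ (castHom d (matZ *ᵥ n))

/-- The map `B_τ → A_τ` itself. -/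
def TorusHom.toHom {d : ℕ} {τ : SiegelSpace d} (f : TorusHom τ) : TorusB τ →+ TorusA τ :=
  QuotientAddGroup.map (latB τ) (latA τ) (Matrix.mulVecLin f.matC).toAddMonoidHom (by
    rintro _ ⟨_, ⟨n, rfl⟩, rfl⟩
    exact ⟨_, ⟨f.matZ *ᵥ n, rfl⟩, (f.comm n).symm⟩)

instance {d : ℕ} (τ : SiegelSpace d) : Sub (TorusHom τ) where
  sub f g :=
    { matC := f.matC - g.matC
      matZ := f.matZ - g.matZ
      comm := fun n => by rw [sub_mulVec, sub_mulVec, f.comm, g.comm, map_sub, map_sub] }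

/-! ### Extensions by `ℂ^×` and the dual morphism -/

/-- The kernel of the exponential map of the extension of `A_τ` by `ℂ^×` attached to `u`: the image
of `ℤ(1) ⊕ M_{2d,1}(ℤ)` in `M_{d,1}(ℂ) ⊕ ℂ` under `(2πi k, m) ↦ (m₁ - τ m₂, 2πi k - u m₂)`. -/
def extLatA {d : ℕ} (τ : SiegelSpace d) (u : Fin d → ℂ) : AddSubgroup ((Fin d → ℂ) × ℂ) where
  carrier := {q | ∃ (k : ℤ) (m : Idx d → ℤ), q = (colMap τ (castHom d m),
    2 * Real.pi * Complex.I * k - u ⬝ᵥ (fun i => (m (Sum.inr i) : ℂ)))}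
  zero_mem' := ⟨0, 0, Prod.ext (by simp) (by simp [dotProduct])⟩
  add_mem' := by
    rintro _ _ ⟨k, m, rfl⟩ ⟨k', m', rfl⟩
    refine ⟨k + k', m + m', Prod.ext (by simp) ?_⟩
    simp only [dotProduct, Prod.mk_add_mk, Pi.add_apply, Int.cast_add, mul_add,
      Finset.sum_add_distrib]
    ring
  neg_mem' := by
    rintro _ ⟨k, m, rfl⟩
    refine ⟨-k, -m, Prod.ext (by simp) ?_⟩
    simp only [dotProduct, Prod.neg_mk, Pi.neg_apply, Int.cast_neg, mul_neg,
      Finset.sum_neg_distrib]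
    ring

/-- The kernel of the exponential map of the extension of `B_τ` by `ℂ^×` attached to `v`: the image
of `ℤ(1) ⊕ M_{1,2d}(ℤ(1))` in `M_{1,d}(ℂ) ⊕ ℂ` under
`(2πi k, 2πi n) ↦ (2πi (n₁ τ + n₂), 2πi k + 2πi n₁ v)`. -/
def extLatB {d : ℕ} (τ : SiegelSpace d) (v : Fin d → ℂ) : Set ((Fin d → ℂ) × ℂ) :=
  {q | ∃ (k : ℤ) (n : Idx d → ℤ), q = (rowMap τ (castHom d n),
    2 * Real.pi * Complex.I * k +
      2 * Real.pi * Complex.I * ((fun i => (n (Sum.inl i) : ℂ)) ⬝ᵥ v))}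

/-- `g` is the dual of `f : B_τ → A_τ`: for every point of `B_τ`, with representative `u`, there is
a morphism of extensions over `f` from the extension of `B_τ` by `ℂ^×` attached to the point
`g(u)` of `A_τ` to the extension of `A_τ` by `ℂ^×` attached to `u`, which is the identity on `ℂ^×`.
The map `ψ` is the induced map on universal covers. -/
def IsDual {d : ℕ} {τ : SiegelSpace d} (f g : TorusHom τ) : Prop :=
  ∀ u : Fin d → ℂ, ∃ ψ : ((Fin d → ℂ) × ℂ) →ₗ[ℂ] ((Fin d → ℂ) × ℂ),
    (∀ w : ℂ, ψ (0, w) = (0, w)) ∧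
    (∀ (u' : Fin d → ℂ) (w : ℂ), (ψ (u', w)).1 = f.matC *ᵥ u') ∧
    (∀ q ∈ extLatB τ (g.matC *ᵥ u), ψ q ∈ extLatA τ u)

/-! ### The Hodge locus `ℍ_{d,α}` -/

/-- The group `GSp(Ψ)(ℝ)` of pairs `(g, μ)` with `Ψ(gx, gy) = μ Ψ(x, y)`, intersected with the
stabiliser of the map `2πi n ↦ a nᵗ` from `M_{1,2d}(ℝ(1))` to `M_{2d,1}(ℝ)`, on whose source
`(g, μ)` acts by `n ↦ μ n g⁻¹`. -/
def stabGroup {d : ℕ} (a : Matrix (Idx d) (Idx d) ℤ) :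
    Subgroup ((Matrix (Idx d) (Idx d) ℝ)ˣ × ℝˣ) where
  carrier := {p | (p.1.1)ᵀ * fromBlocks 0 (-1) 1 0 * p.1.1 = p.2.1 • fromBlocks 0 (-1) 1 0 ∧
    p.1.1 * a.map (Int.cast : ℤ → ℝ) = p.2.1 • (a.map (Int.cast : ℤ → ℝ) * (p.1⁻¹).1ᵀ)}
  one_mem' := by simp
  mul_mem' := by
    rintro ⟨g, μ⟩ ⟨g', μ'⟩ ⟨h1, h2⟩ ⟨h1', h2'⟩
    simp only at h1 h2 h1' h2'
    refine ⟨?_, ?_⟩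
    · simp only [Prod.mk_mul_mk, Units.val_mul, transpose_mul]
      calc _ = g'.1ᵀ * (g.1ᵀ * fromBlocks 0 (-1) 1 0 * g.1) * g'.1 := by
            simp only [Matrix.mul_assoc]
        _ = _ := by rw [h1]; simp only [Matrix.mul_smul, Matrix.smul_mul, h1', smul_smul]
    · simp only [Prod.mk_mul_mk, Units.val_mul, _root_.mul_inv_rev, transpose_mul]
      rw [Matrix.mul_assoc, h2', Matrix.mul_smul, ← Matrix.mul_assoc, h2, Matrix.smul_mul,
        smul_smul, Matrix.mul_assoc, mul_comm]
  inv_mem' := by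
    rintro ⟨g, μ⟩ ⟨h1, h2⟩
    simp only at h1 h2
    have e1 : g.1 * (g⁻¹).1 = 1 := by simp
    have e2 : (g⁻¹).1 * g.1 = 1 := by simp
    have e3 : ((g⁻¹).1)ᵀ * g.1ᵀ = 1 := by rw [← transpose_mul, e1, transpose_one]
    have em : (μ⁻¹).1 * μ.1 = 1 := by simp
    refine ⟨?_, ?_⟩
    · simp only [Prod.inv_mk]
      calc _ = (μ⁻¹).1 • (((g⁻¹).1)ᵀ * (μ.1 • fromBlocks 0 (-1) 1 0) * (g⁻¹).1) := by
            rw [Matrix.mul_smul, Matrix.smul_mul, smul_smul, em, one_smul]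
        _ = (μ⁻¹).1 • ((((g⁻¹).1)ᵀ * g.1ᵀ) * fromBlocks 0 (-1) 1 0 * (g.1 * (g⁻¹).1)) := by
            rw [← h1]; simp only [Matrix.mul_assoc]
        _ = _ := by rw [e3, e1, Matrix.one_mul, Matrix.mul_one]
    · simp only [Prod.inv_mk, inv_inv]
      calc _ = (μ⁻¹).1 • ((g⁻¹).1 * (μ.1 • (a.map (Int.cast : ℤ → ℝ) * ((g⁻¹).1)ᵀ)) * g.1ᵀ) := by
            rw [Matrix.mul_smul, Matrix.smul_mul, smul_smul, em, one_smul, Matrix.mul_assoc,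
              Matrix.mul_assoc, e3, Matrix.mul_one]
        _ = (μ⁻¹).1 • ((g⁻¹).1 * g.1 * (a.map (Int.cast : ℤ → ℝ)) * g.1ᵀ) := by
            rw [← h2]; simp only [Matrix.mul_assoc]
        _ = _ := by rw [e2, Matrix.one_mul]

/-- The orbit `ℍ_{d,α} = G_α(ℝ)^+ · τ₀`, where `G_α(ℝ)^+` is the identity component of the
stabiliser and `(g, μ)` sends `τ₀` to the `τ` with `M_τ^{0,-1} = g M_{τ₀}^{0,-1}`. -/
def siegelOrbit {d : ℕ} (τ₀ : SiegelSpace d) (a : Matrix (Idx d) (Idx d) ℤ) :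
    Set (SiegelSpace d) :=
  {τ | ∃ p ∈ Subgroup.connectedComponentOfOne (stabGroup a),
    hodgeSub τ = (hodgeSub τ₀).map (Matrix.mulVecLin (p.1.1.1.map (Complex.ofReal)))}

/-! ### Mixed Hodge structures on `M = ℤ(1) ⊕ ℤ^{2d} ⊕ ℤ` -/

/-- `M_ℂ`, with coordinates in the basis `e_0, e_1, …, e_{2d}, e_{2d+1}`. -/
abbrev HodgeSpace (d : ℕ) := ℂ × (Idx d → ℂ) × ℂ

/-- The fibre at `τ` of the space `D` of mixed Hodge structures on `M` of type
`{(-1,-1), (-1,0), (0,-1), (0,0)}`. Such a structure is given by `F = F^0 M_ℂ`; the three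
conditions say that `F` induces `0` on `Gr_{-2}`, `M_τ^{0,-1}` on `Gr_{-1}` and everything on
`Gr_0`. -/
def MHS {d : ℕ} (τ : SiegelSpace d) : Type :=
  {F : Submodule ℂ (HodgeSpace d) //
    (∀ a : ℂ, ((a, 0, 0) : HodgeSpace d) ∈ F → a = 0) ∧
    (∀ b : Idx d → ℂ, (∃ a : ℂ, ((a, b, 0) : HodgeSpace d) ∈ F) ↔ b ∈ hodgeSub τ) ∧
    (∀ c : ℂ, ∃ (a : ℂ) (b : Idx d → ℂ), ((a, b, c) : HodgeSpace d) ∈ F)}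

/-- The linear map `ℂ^{d+1} → M_ℂ` with matrix `(u w; τ v; 1_d 0; 0 1)`. -/
def frame {d : ℕ} (τ : SiegelSpace d) (u v : Fin d → ℂ) (w : ℂ) :
    ((Fin d → ℂ) × ℂ) →ₗ[ℂ] HodgeSpace d where
  toFun q := (u ⬝ᵥ q.1 + w * q.2, Sum.elim (τ.1 *ᵥ q.1 + q.2 • v) q.1, q.2)
  map_add' p q := by
    refine Prod.ext ?_ (Prod.ext ?_ rfl)
    · simp only [Prod.fst_add, Prod.snd_add, dotProduct_add]; ring
    · ext (i | i)
      · simp [mulVec_add]; ring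
      · simp
  map_smul' c p := by
    refine Prod.ext ?_ (Prod.ext ?_ rfl)
    · simp only [Prod.smul_fst, Prod.smul_snd, dotProduct_smul, smul_eq_mul, RingHom.id_apply]
      ring
    · ext (i | i)
      · simp [mulVec_smul]; ring
      · simp

theorem mem_frame {d : ℕ} (τ : SiegelSpace d) (u v : Fin d → ℂ) (w a c : ℂ) (b : Idx d → ℂ) :
    ((a, b, c) : HodgeSpace d) ∈ LinearMap.range (frame τ u v w) ↔
      a = u ⬝ᵥ (fun i => b (Sum.inr i)) + w * c ∧
      (fun i => b (Sum.inl i)) = τ.1 *ᵥ (fun i => b (Sum.inr i)) + c • v := by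
  constructor
  · rintro ⟨⟨s, c'⟩, h⟩
    simp only [frame, LinearMap.coe_mk, AddHom.coe_mk, Prod.mk.injEq] at h
    obtain ⟨rfl, rfl, rfl⟩ := h
    exact ⟨rfl, rfl⟩
  · rintro ⟨rfl, h⟩
    refine ⟨(fun i => b (Sum.inr i), c), ?_⟩
    simp only [frame, LinearMap.coe_mk, AddHom.coe_mk, Prod.mk.injEq, true_and, and_true]
    rw [← h]
    ext (i | i) <;> rfl

/-- The point of `D` with coordinates `(τ, u, v, w)`. -/
def ofCoords {d : ℕ} (τ : SiegelSpace d) (u v : Fin d → ℂ) (w : ℂ) : MHS τ :=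
  ⟨LinearMap.range (frame τ u v w), by
    refine ⟨fun a h => ?_, fun b => ⟨?_, ?_⟩, fun c => ?_⟩
    · rw [mem_frame] at h
      simpa [dotProduct] using h.1
    · rintro ⟨a, h⟩
      rw [mem_frame] at h
      refine ⟨fun i => b (Sum.inr i), ?_⟩
      have h2 := h.2
      rw [zero_smul, add_zero] at h2
      rw [← h2]
      ext (i | i) <;> rfl
    · rintro ⟨s, rfl⟩
      exact ⟨u ⬝ᵥ s, by rw [mem_frame]; simp⟩
    · exact ⟨w * c, Sum.elim (c • v) 0, by
        rw [mem_frame]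
        refine ⟨?_, ?_⟩
        · simp [dotProduct]
        · ext i; simp [mulVec, dotProduct]⟩⟩

theorem ofCoords_injective {d : ℕ} (τ : SiegelSpace d) {u u' v v' : Fin d → ℂ} {w w' : ℂ}
    (h : ofCoords τ u v w = ofCoords τ u' v' w') : u = u' ∧ v = v' ∧ w = w' := by
  have h' : LinearMap.range (frame τ u v w) = LinearMap.range (frame τ u' v' w') :=
    congrArg Subtype.val h
  have h0 : frame τ u v w (0, 1) ∈ LinearMap.range (frame τ u' v' w') := h' ▸ ⟨_, rfl⟩
  have h1 : ∀ s, frame τ u v w (s, 0) ∈ LinearMap.range (frame τ u' v' w') :=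
    fun s => h' ▸ ⟨_, rfl⟩
  simp only [frame, LinearMap.coe_mk, AddHom.coe_mk] at h0 h1
  change (_, _, _) ∈ LinearMap.range (frame τ u' v' w') at h0
  rw [mem_frame] at h0
  refine ⟨?_, ?_, ?_⟩
  · ext i
    have := ((mem_frame ..).1 (h1 (Pi.single i 1))).1
    simpa using this
  · ext i
    have := congrFun h0.2 i
    simpa [mulVec, dotProduct] using this
  · simpa [dotProduct] using h0.1

theorem ofCoords_surjective {d : ℕ} (τ : SiegelSpace d) (F : MHS τ) :
    ∃ u v w, ofCoords τ u v w = F := by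
  obtain ⟨F, hF1, hF2, hF3⟩ := F
  have hs : ∀ s : Fin d → ℂ, ∃ a : ℂ, ((a, Sum.elim (τ.1 *ᵥ s) s, 0) : HodgeSpace d) ∈ F :=
    fun s => (hF2 _).2 ⟨s, rfl⟩
  choose φ hφ using hs
  obtain ⟨a₁, b₁, h₁⟩ := hF3 1
  have key : ∀ (a : ℂ) (b : Idx d → ℂ) (c : ℂ), ((a, b, c) : HodgeSpace d) ∈ F →
      ∀ a' : ℂ, ((a', b, c) : HodgeSpace d) ∈ F → a' = a := by
    intro a b c h a' h'
    have := F.sub_mem h' h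
    simp only [Prod.mk_sub_mk, sub_self] at this
    exact sub_eq_zero.1 (hF1 _ this)
  have hadd : ∀ s t, φ (s + t) = φ s + φ t := by
    intro s t
    refine key _ _ _ (?_ : ((φ s + φ t, Sum.elim (τ.1 *ᵥ (s + t)) (s + t), 0) : HodgeSpace d) ∈ F)
      _ (hφ _)
    have := F.add_mem (hφ s) (hφ t)
    convert this using 1
    refine Prod.ext rfl (Prod.ext ?_ (by simp))
    ext (i | i) <;> simp [mulVec_add]
  have hsmul : ∀ (c : ℂ) s, φ (c • s) = c • φ s := by
    intro c s
    refine key _ _ _ (?_ : ((c • φ s, Sum.elim (τ.1 *ᵥ (c • s)) (c • s), 0) : HodgeSpace d) ∈ F)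
      _ (hφ _)
    have := F.smul_mem c (hφ s)
    convert this using 1
    refine Prod.ext rfl (Prod.ext ?_ (by simp))
    ext (i | i) <;> simp [mulVec_smul]
  let φL : (Fin d → ℂ) →ₗ[ℂ] ℂ := ⟨⟨φ, hadd⟩, hsmul⟩
  let u : Fin d → ℂ := fun i => φ (Pi.single i 1)
  have hu : ∀ s, φ s = u ⬝ᵥ s := by
    intro s
    have : φL s = ∑ i, s i • φL (Pi.single i 1) := by
      conv_lhs => rw [pi_eq_sum_univ' s]
      simp [map_sum]
    change φL s = _
    rw [this]
    simp only [dotProduct, smul_eq_mul]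
    exact Finset.sum_congr rfl fun i _ => mul_comm _ _
  let s₁ : Fin d → ℂ := fun i => b₁ (Sum.inr i)
  let v : Fin d → ℂ := fun i => b₁ (Sum.inl i) - (τ.1 *ᵥ s₁) i
  have h₂ : ((a₁ - φ s₁, Sum.elim v 0, 1) : HodgeSpace d) ∈ F := by
    have := F.sub_mem h₁ (hφ s₁)
    convert this using 1
    refine Prod.ext rfl (Prod.ext ?_ (by simp))
    ext (i | i) <;> simp [v, s₁]
  refine ⟨u, v, a₁ - φ s₁, Subtype.ext ?_⟩
  have hmem : ∀ (s : Fin d → ℂ) (c : ℂ), frame τ u v (a₁ - φ s₁) (s, c) ∈ F := by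
    intro s c
    have := F.add_mem (hφ s) (F.smul_mem c h₂)
    convert this using 1
    refine Prod.ext ?_ (Prod.ext ?_ ?_)
    · simp [frame, hu]; ring
    · ext (i | i) <;> simp [frame]
    · simp [frame]
  apply le_antisymm
  · rintro _ ⟨⟨s, c⟩, rfl⟩
    exact hmem s c
  · rintro ⟨a, b, c⟩ h
    have h3 := F.sub_mem h (F.smul_mem c h₂)
    have h4 : ((a - c * (a₁ - φ s₁), b - c • Sum.elim v 0, 0) : HodgeSpace d) ∈ F := by
      convert h3 using 1
      simp
    obtain ⟨s, hs⟩ := (hF2 _).1 ⟨_, h4⟩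
    have hb : b = Sum.elim (τ.1 *ᵥ s + c • v) s := by
      ext (i | i)
      · have := congrFun hs (Sum.inl i)
        simp at this ⊢
        linear_combination this
      · have := congrFun hs (Sum.inr i)
        simpa using this
    have h5 := hmem s c
    have ha : a = u ⬝ᵥ s + (a₁ - φ s₁) * c := by
      refine key _ b c ?_ _ h
      rw [hb]; exact h5
    refine ⟨(s, c), ?_⟩
    rw [ha, hb]; rfl

/-- The coordinates `(u, v, w)` on the fibre of `D` at `τ`. -/
def coords {d : ℕ} (τ : SiegelSpace d) :
    ((Fin d → ℂ) × (Fin d → ℂ) × ℂ) ≃ MHS τ :=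
  Equiv.ofBijective (fun q => ofCoords τ q.1 q.2.1 q.2.2) ⟨by
    rintro ⟨u, v, w⟩ ⟨u', v', w'⟩ h
    obtain ⟨rfl, rfl, rfl⟩ := ofCoords_injective τ h
    rfl, fun F => by
    obtain ⟨u, v, w, h⟩ := ofCoords_surjective τ F
    exact ⟨(u, v, w), h⟩⟩

/-- The fibre of `D` carries the topology of `M_{1,d}(ℂ) × M_{d,1}(ℂ) × ℂ`. -/
instance {d : ℕ} (τ : SiegelSpace d) : TopologicalSpace (MHS τ) :=
  TopologicalSpace.induced (coords τ).symm inferInstance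

/-! ### The Heisenberg group and the Poincaré torsor -/

/-- The group `P^u(ℝ) U(ℂ)` of matrices `(1 x z; 0 1 y; 0 0 1)` with `x`, `y` real and `z`
complex, in the basis `2πi e_0, e_1, …, e_{2d+1}`. -/
@[ext] structure Heis (d : ℕ) where
  x : Idx d → ℝ
  y : Idx d → ℝ
  z : ℂ

instance (d : ℕ) : Group (Heis d) where
  mul p q := ⟨p.x + q.x, p.y + q.y, p.z + q.z + ((p.x ⬝ᵥ q.y : ℝ) : ℂ)⟩
  one := ⟨0, 0, 0⟩
  inv p := ⟨-p.x, -p.y, -p.z + ((p.x ⬝ᵥ p.y : ℝ) : ℂ)⟩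
  mul_assoc p q r := by
    refine Heis.ext (add_assoc _ _ _) (add_assoc _ _ _) ?_
    change p.z + q.z + ((p.x ⬝ᵥ q.y : ℝ) : ℂ) + r.z + (((p.x + q.x) ⬝ᵥ r.y : ℝ) : ℂ) =
      p.z + (q.z + r.z + ((q.x ⬝ᵥ r.y : ℝ) : ℂ)) + ((p.x ⬝ᵥ (q.y + r.y) : ℝ) : ℂ)
    rw [add_dotProduct, dotProduct_add]; push_cast; ring
  one_mul p := by
    refine Heis.ext (zero_add _) (zero_add _) ?_
    change 0 + p.z + (((0 : Idx d → ℝ) ⬝ᵥ p.y : ℝ) : ℂ) = p.z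
    simp
  mul_one p := by
    refine Heis.ext (add_zero _) (add_zero _) ?_
    change p.z + 0 + ((p.x ⬝ᵥ (0 : Idx d → ℝ) : ℝ) : ℂ) = p.z
    simp
  inv_mul_cancel p := by
    refine Heis.ext (neg_add_cancel _) (neg_add_cancel _) ?_
    change -p.z + ((p.x ⬝ᵥ p.y : ℝ) : ℂ) + p.z + (((-p.x) ⬝ᵥ p.y : ℝ) : ℂ) = 0
    rw [neg_dotProduct]; push_cast; ring

theorem Heis.mul_def {d : ℕ} (p q : Heis d) :
    p * q = ⟨p.x + q.x, p.y + q.y, p.z + q.z + ((p.x ⬝ᵥ q.y : ℝ) : ℂ)⟩ := rfl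

theorem Heis.one_def {d : ℕ} : (1 : Heis d) = ⟨0, 0, 0⟩ := rfl

theorem Heis.inv_def {d : ℕ} (p : Heis d) :
    p⁻¹ = ⟨-p.x, -p.y, -p.z + ((p.x ⬝ᵥ p.y : ℝ) : ℂ)⟩ := rfl

/-- The action on `M_ℂ`; in the basis `e_0, …, e_{2d+1}` the matrix is
`(1 2πi x 2πi z; 0 1 y; 0 0 1)`. -/
def Heis.act {d : ℕ} (p : Heis d) : HodgeSpace d →ₗ[ℂ] HodgeSpace d where
  toFun q := (q.1 + 2 * Real.pi * Complex.I * ((fun i => (p.x i : ℂ)) ⬝ᵥ q.2.1)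
      + 2 * Real.pi * Complex.I * p.z * q.2.2,
    q.2.1 + q.2.2 • (fun i => (p.y i : ℂ)), q.2.2)
  map_add' q q' := by
    refine Prod.ext ?_ (Prod.ext ?_ rfl)
    · simp only [Prod.fst_add, Prod.snd_add, dotProduct_add]; ring
    · simp only [Prod.fst_add, Prod.snd_add, add_smul]; abel
  map_smul' c q := by
    refine Prod.ext ?_ (Prod.ext ?_ rfl)
    · simp only [Prod.smul_fst, Prod.smul_snd, dotProduct_smul, smul_eq_mul, RingHom.id_apply]
      ring
    · simp only [Prod.smul_fst, Prod.smul_snd, smul_add, smul_smul, smul_eq_mul,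
        RingHom.id_apply]

theorem Heis.act_one {d : ℕ} : (1 : Heis d).act = LinearMap.id := by
  refine LinearMap.ext fun q => Prod.ext ?_ (Prod.ext ?_ rfl)
  · simp [Heis.act, Heis.one_def, dotProduct]
  · ext i; simp [Heis.act, Heis.one_def]

theorem Heis.act_mul {d : ℕ} (p q : Heis d) : (p * q).act = p.act ∘ₗ q.act := by
  refine LinearMap.ext fun m => Prod.ext ?_ (Prod.ext ?_ rfl)
  · simp only [Heis.act, Heis.mul_def, LinearMap.coe_mk, AddHom.coe_mk, LinearMap.comp_apply,
      dotProduct, Pi.add_apply, Pi.smul_apply, Complex.ofReal_add, Complex.ofReal_sum,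
      Complex.ofReal_mul, add_mul, mul_add, Finset.sum_add_distrib, smul_eq_mul]
    have : ∑ i, (p.x i : ℂ) * (m.2.2 * (q.y i : ℂ)) = (∑ i, (p.x i : ℂ) * (q.y i : ℂ)) * m.2.2 := by
      rw [Finset.sum_mul]; exact Finset.sum_congr rfl fun i _ => by ring
    rw [this]; ring
  · ext i
    simp only [Heis.act, Heis.mul_def, LinearMap.coe_mk, AddHom.coe_mk, LinearMap.comp_apply,
      Pi.add_apply, Pi.smul_apply, Complex.ofReal_add, smul_eq_mul]
    ring

theorem Heis.map_frame {d : ℕ} (p : Heis d) (τ : SiegelSpace d) (u v : Fin d → ℂ) (w : ℂ) :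
    (LinearMap.range (frame τ u v w)).map p.act = LinearMap.range (frame τ (u + rowMap τ p.x)
      (v + colMap τ p.y)
      (w + 2 * Real.pi * Complex.I * ((fun i => (p.x (Sum.inl i) : ℂ)) ⬝ᵥ v)
        + 2 * Real.pi * Complex.I * p.z
        - (u + rowMap τ p.x) ⬝ᵥ (fun i => (p.y (Sum.inr i) : ℂ)))) := by
  have hvec : ∀ s : Fin d → ℂ, rowMap τ p.x ⬝ᵥ s = 2 * Real.pi * Complex.I *
      ((fun i => (p.x (Sum.inl i) : ℂ)) ⬝ᵥ (τ.1 *ᵥ s) +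
        (fun i => (p.x (Sum.inr i) : ℂ)) ⬝ᵥ s) := by
    intro s
    simp only [rowMap, AddMonoidHom.coe_mk, ZeroHom.coe_mk, smul_dotProduct, add_dotProduct,
      dotProduct_mulVec, smul_eq_mul]
  have hpt : ∀ (s : Fin d → ℂ) (c : ℂ), p.act (frame τ u v w (s, c)) =
      frame τ (u + rowMap τ p.x) (v + colMap τ p.y)
      (w + 2 * Real.pi * Complex.I * ((fun i => (p.x (Sum.inl i) : ℂ)) ⬝ᵥ v)
        + 2 * Real.pi * Complex.I * p.z
        - (u + rowMap τ p.x) ⬝ᵥ (fun i => (p.y (Sum.inr i) : ℂ)))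
      (s + c • (fun i => (p.y (Sum.inr i) : ℂ)), c) := by
    intro s c
    refine Prod.ext ?_ (Prod.ext ?_ rfl)
    · simp only [Heis.act, frame, LinearMap.coe_mk, AddHom.coe_mk, add_dotProduct, dotProduct_add,
        dotProduct_smul, hvec, mulVec_add, mulVec_smul]
      have h : (fun i => (p.x i : ℂ)) ⬝ᵥ Sum.elim (τ.1 *ᵥ s + c • v) s =
          (fun i => (p.x (Sum.inl i) : ℂ)) ⬝ᵥ (τ.1 *ᵥ s + c • v) +
          (fun i => (p.x (Sum.inr i) : ℂ)) ⬝ᵥ s := by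
        simp only [dotProduct, Fintype.sum_sum_type, Sum.elim_inl, Sum.elim_inr]
      rw [h, dotProduct_add, dotProduct_smul]
      simp only [smul_eq_mul]
      ring
    · ext (i | i)
      · simp [Heis.act, frame, colMap, mulVec_add, mulVec_smul]; ring
      · simp [Heis.act, frame]
  apply le_antisymm
  · rintro _ ⟨_, ⟨⟨s, c⟩, rfl⟩, rfl⟩
    exact ⟨_, (hpt s c).symm⟩
  · rintro _ ⟨⟨s, c⟩, rfl⟩
    refine ⟨_, ⟨(s - c • (fun i => (p.y (Sum.inr i) : ℂ)), c), rfl⟩, ?_⟩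
    rw [hpt, sub_add_cancel]

/-- The action of `P^u(ℝ) U(ℂ)` on the fibre of `D` at `τ`: `F ↦ p F`. -/
instance {d : ℕ} (τ : SiegelSpace d) : MulAction (Heis d) (MHS τ) where
  smul p F := ⟨F.1.map p.act, by
    obtain ⟨u, v, w, rfl⟩ := ofCoords_surjective τ F
    have h := p.map_frame τ u v w
    change (_ : Prop) ∧ _
    simp only [ofCoords, h]
    exact (ofCoords τ _ _ _).2⟩
  one_smul F := Subtype.ext (by
    change F.1.map (1 : Heis d).act = F.1
    rw [Heis.act_one, Submodule.map_id])
  mul_smul p q F := Subtype.ext (by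
    change F.1.map (p * q).act = (F.1.map q.act).map p.act
    rw [Heis.act_mul, Submodule.map_comp])

theorem smul_ofCoords {d : ℕ} (p : Heis d) (τ : SiegelSpace d) (u v : Fin d → ℂ) (w : ℂ) :
    p • ofCoords τ u v w = ofCoords τ (u + rowMap τ p.x) (v + colMap τ p.y)
      (w + 2 * Real.pi * Complex.I * ((fun i => (p.x (Sum.inl i) : ℂ)) ⬝ᵥ v)
        + 2 * Real.pi * Complex.I * p.z
        - (u + rowMap τ p.x) ⬝ᵥ (fun i => (p.y (Sum.inr i) : ℂ))) :=
  Subtype.ext (p.map_frame τ u v w)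

/-- The point `τ̃` of `D` with coordinates `(τ, 0, 0, 0)`. -/
def baseMHS {d : ℕ} (τ : SiegelSpace d) : MHS τ := ofCoords τ 0 0 0

/-- The subgroup `P^u(ℤ)` of matrices with integral entries. -/
def heisInt (d : ℕ) : Subgroup (Heis d) where
  carrier := {p | ∃ (m n : Idx d → ℤ) (k : ℤ), p = ⟨castHom d m, castHom d n, (k : ℂ)⟩}
  one_mem' := ⟨0, 0, 0, by simp [Heis.one_def]⟩
  mul_mem' := by
    rintro _ _ ⟨m, n, k, rfl⟩ ⟨m', n', k', rfl⟩
    refine ⟨m + m', n + n', k + k' + m ⬝ᵥ n', ?_⟩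
    rw [Heis.mul_def]
    refine Heis.ext (map_add _ _ _).symm (map_add _ _ _).symm ?_
    simp [castHom, dotProduct]
  inv_mem' := by
    rintro _ ⟨m, n, k, rfl⟩
    refine ⟨-m, -n, -k + m ⬝ᵥ n, ?_⟩
    rw [Heis.inv_def]
    refine Heis.ext (map_neg _ _).symm (map_neg _ _).symm ?_
    simp [castHom, dotProduct]

/-- The Poincaré torsor on `A_τ × B_τ`: the fibre at `τ` of `P^u(ℤ) \ D`. -/
abbrev PoincareTorsor {d : ℕ} (τ : SiegelSpace d) : Type :=
  MulAction.orbitRel.Quotient (heisInt d) (MHS τ)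

/-- The quotient `P^u(ℤ) \ P^u(ℝ) U(ℂ)`. -/
abbrev HeisQuot (d : ℕ) : Type := MulAction.orbitRel.Quotient (heisInt d) (Heis d)

/-- The class in the Poincaré torsor of a point of `D`. -/
def pmk {d : ℕ} {τ : SiegelSpace d} (F : MHS τ) : PoincareTorsor τ := Quotient.mk _ F

/-- The class in `P^u(ℤ) \ P^u(ℝ) U(ℂ)` of an element of `P^u(ℝ) U(ℂ)`. -/
def hmk {d : ℕ} (p : Heis d) : HeisQuot d := Quotient.mk _ p

theorem pmk_eq_iff {d : ℕ} {τ : SiegelSpace d} (F F' : MHS τ) :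
    pmk F = pmk F' ↔ ∃ p ∈ heisInt d, p • F' = F := by
  unfold pmk
  rw [Quotient.eq, MulAction.orbitRel_apply]
  constructor
  · rintro ⟨⟨p, hp⟩, h⟩
    exact ⟨p, hp, h⟩
  · rintro ⟨p, hp, h⟩
    exact ⟨⟨p, hp⟩, h⟩

/-- The map `P^u(ℤ) \ P^u(ℝ) U(ℂ) → P^u(ℤ) \ D_τ` induced by `p ↦ p τ̃`. -/
def orbitMap {d : ℕ} (τ : SiegelSpace d) : HeisQuot d → PoincareTorsor τ :=
  Quotient.lift (fun p => pmk (p • baseMHS τ)) (by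
    intro p q h
    obtain ⟨⟨r, hr⟩, rfl⟩ := MulAction.orbitRel_apply.1 h
    exact (pmk_eq_iff _ _).2 ⟨r, hr, (mul_smul r q (baseMHS τ)).symm⟩)

/-- The element of `P^u(ℝ)` given by a real row `x`. -/
def rowElt {d : ℕ} (x : Idx d → ℝ) : Heis d := ⟨x, 0, 0⟩

/-- The projection of the Poincaré torsor to `B_τ`, given by the coordinate `u`. -/
def projB {d : ℕ} (τ : SiegelSpace d) : PoincareTorsor τ → TorusB τ :=
  Quotient.lift (fun F => (QuotientAddGroup.mk ((coords τ).symm F).1 : TorusB τ)) (by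
    intro F F' h
    obtain ⟨⟨p, hp⟩, rfl⟩ := MulAction.orbitRel_apply.1 h
    obtain ⟨m, n, k, hk⟩ := hp
    obtain ⟨⟨u, v, w⟩, rfl⟩ := (coords τ).surjective F'
    change (QuotientAddGroup.mk ((coords τ).symm (p • ofCoords τ u v w)).1 : TorusB τ) = _
    rw [smul_ofCoords, hk]
    change (QuotientAddGroup.mk ((coords τ).symm (coords τ (_, _, _))).1 : TorusB τ) = _
    rw [Equiv.symm_apply_apply, Equiv.symm_apply_apply]
    refine (QuotientAddGroup.eq).2 ?_
    refine ⟨_, ⟨-m, rfl⟩, ?_⟩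
    simp)

/-- The projection of the Poincaré torsor to `A_τ`, given by the coordinate `v`. -/
def projA {d : ℕ} (τ : SiegelSpace d) : PoincareTorsor τ → TorusA τ :=
  Quotient.lift (fun F => (QuotientAddGroup.mk ((coords τ).symm F).2.1 : TorusA τ)) (by
    intro F F' h
    obtain ⟨⟨p, hp⟩, rfl⟩ := MulAction.orbitRel_apply.1 h
    obtain ⟨m, n, k, hk⟩ := hp
    obtain ⟨⟨u, v, w⟩, rfl⟩ := (coords τ).surjective F'
    change (QuotientAddGroup.mk ((coords τ).symm (p • ofCoords τ u v w)).2.1 : TorusA τ) = _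
    rw [smul_ofCoords, hk]
    change (QuotientAddGroup.mk ((coords τ).symm (coords τ (_, _, _))).2.1 : TorusA τ) = _
    rw [Equiv.symm_apply_apply, Equiv.symm_apply_apply]
    refine (QuotientAddGroup.eq).2 ?_
    refine ⟨_, ⟨-n, rfl⟩, ?_⟩
    simp)

theorem projB_pmk {d : ℕ} (τ : SiegelSpace d) (u v : Fin d → ℂ) (w : ℂ) :
    projB τ (pmk (ofCoords τ u v w)) = QuotientAddGroup.mk u := by
  change (QuotientAddGroup.mk ((coords τ).symm (coords τ (u, v, w))).1 : TorusB τ) = _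
  rw [Equiv.symm_apply_apply]

theorem projA_pmk {d : ℕ} (τ : SiegelSpace d) (u v : Fin d → ℂ) (w : ℂ) :
    projA τ (pmk (ofCoords τ u v w)) = QuotientAddGroup.mk v := by
  change (QuotientAddGroup.mk ((coords τ).symm (coords τ (u, v, w))).2.1 : TorusA τ) = _
  rw [Equiv.symm_apply_apply]

/-! ### The extension `E_{τ,b}` as a fibre of the Poincaré torsor -/

/-- The underlying space of the extension of `A_τ` by `ℂ^×` corresponding to `b` in `B_τ`: the
fibre of the Poincaré torsor over `b`, with the topology of a subspace. -/
def Extn {d : ℕ} (τ : SiegelSpace d) (b : TorusB τ) : Type := {P : PoincareTorsor τ // projB τ P = b}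

instance {d : ℕ} (τ : SiegelSpace d) (b : TorusB τ) : TopologicalSpace (Extn τ b) :=
  inferInstanceAs (TopologicalSpace {P : PoincareTorsor τ // projB τ P = b})

/-- The point `[u, v, w]` of the fibre over the class `b` of `u`. -/
def extMk {d : ℕ} {τ : SiegelSpace d} {b : TorusB τ} (u : Fin d → ℂ)
    (hu : QuotientAddGroup.mk u = b) (q : (Fin d → ℂ) × ℂ) : Extn τ b :=
  ⟨pmk (ofCoords τ u q.1 q.2), (projB_pmk τ u q.1 q.2).trans hu⟩

theorem rowMap_injective {d : ℕ} (τ : SiegelSpace d) : Function.Injective (rowMap τ) := by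
  rw [injective_iff_map_eq_zero]
  intro x hx
  have hpi : (2 * Real.pi * Complex.I : ℂ) ≠ 0 := Complex.two_pi_I_ne_zero
  have h : (fun i => (x (Sum.inl i) : ℂ)) ᵥ* τ.1 + (fun i => (x (Sum.inr i) : ℂ)) = 0 :=
    (smul_eq_zero.1 hx).resolve_left hpi
  have h1 : (fun i => x (Sum.inl i)) ᵥ* τ.1.map Complex.im = 0 := by
    ext j
    have := congrArg Complex.im (congrFun h j)
    simpa [vecMul, dotProduct] using this
  have hunit : IsUnit (τ.1.map Complex.im) := τ.2.2.isUnit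
  have h2 : (fun i => x (Sum.inl i)) = 0 := by
    have := congrArg (fun y => y ᵥ* (τ.1.map Complex.im)⁻¹) h1
    simpa [vecMul_vecMul, Matrix.mul_nonsing_inv _ ((Matrix.isUnit_iff_isUnit_det _).1 hunit)]
      using this
  ext (i | i)
  · exact congrFun h2 i
  · have := congrFun h i
    have h3 : ∀ j, x (Sum.inl j) = 0 := fun j => congrFun h2 j
    simpa [vecMul, dotProduct, h3] using this

theorem extMk_eq_iff {d : ℕ} {τ : SiegelSpace d} {b : TorusB τ} (u : Fin d → ℂ)
    (hu : QuotientAddGroup.mk u = b) (q q' : (Fin d → ℂ) × ℂ) :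
    extMk u hu q = extMk u hu q' ↔ -q + q' ∈ extLatA τ u := by
  have h0 : extMk u hu q = extMk u hu q' ↔
      pmk (ofCoords τ u q'.1 q'.2) = pmk (ofCoords τ u q.1 q.2) :=
    ⟨fun h => (congrArg Subtype.val h).symm, fun h => Subtype.ext h.symm⟩
  rw [h0, pmk_eq_iff]
  constructor
  · rintro ⟨_, ⟨m, n, k, rfl⟩, h⟩
    rw [smul_ofCoords] at h
    obtain ⟨h1, h2, h3⟩ := ofCoords_injective τ h
    simp only at h1 h2 h3
    have hm : castHom d m = 0 := rowMap_injective τ (by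
      rw [map_zero]; exact add_eq_left.1 h1)
    rw [hm] at h3
    refine ⟨k, n, Prod.ext ?_ ?_⟩
    · simp [← h2]
    · simp only [Prod.snd_add, Prod.snd_neg, ← h3, map_zero, add_zero]
      simp [castHom, dotProduct]; ring
  · rintro ⟨k, n, h⟩
    refine ⟨_, ⟨0, n, k, rfl⟩, ?_⟩
    have h1 := congrArg Prod.fst h
    have h2 := congrArg Prod.snd h
    simp only [Prod.fst_add, Prod.fst_neg, Prod.snd_add, Prod.snd_neg] at h1 h2
    rw [smul_ofCoords]
    have e1 : q'.1 = q.1 + colMap τ (castHom d n) := by rw [← h1]; abel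
    have e2 : q'.2 = q.2 + (2 * Real.pi * Complex.I * k - u ⬝ᵥ (fun i => (n (Sum.inr i) : ℂ))) := by
      rw [← h2]; ring
    rw [e1, e2]
    simp only [map_zero, add_zero]
    congr 1
    simp [castHom, dotProduct]; ring

theorem extMk_surjective {d : ℕ} {τ : SiegelSpace d} {b : TorusB τ} (u : Fin d → ℂ)
    (hu : QuotientAddGroup.mk u = b) : Function.Surjective (extMk (τ := τ) u hu) := by
  rintro ⟨P, hP⟩
  induction P using Quotient.inductionOn with
  | h F =>
  obtain ⟨u', v, w, rfl⟩ := ofCoords_surjective τ F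
  have hP' : (QuotientAddGroup.mk u' : TorusB τ) = QuotientAddGroup.mk u :=
    ((projB_pmk τ u' v w).symm.trans hP).trans hu.symm
  obtain ⟨_, ⟨n, rfl⟩, hn⟩ := (QuotientAddGroup.eq).1 hP'
  refine ⟨(v, w + 2 * Real.pi * Complex.I * ((fun i => (n (Sum.inl i) : ℂ)) ⬝ᵥ v)), ?_⟩
  refine Subtype.ext ((pmk_eq_iff _ _).2 ⟨_, ⟨n, 0, 0, rfl⟩, ?_⟩)
  rw [smul_ofCoords]
  have e : u = u' + rowMap τ (castHom d n) := by rw [hn]; abel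
  simp only [map_zero, add_zero, ← e]
  congr 1
  simp [castHom, dotProduct]

/-- The fibre over the class of `u` is the cokernel of `ℤ(1) ⊕ M_{2d,1}(ℤ) → M_{d,1}(ℂ) ⊕ ℂ`. -/
def fibreEquiv {d : ℕ} {τ : SiegelSpace d} {b : TorusB τ} (u : Fin d → ℂ)
    (hu : QuotientAddGroup.mk u = b) : (((Fin d → ℂ) × ℂ) ⧸ extLatA τ u) ≃ Extn τ b :=
  Equiv.ofBijective (fun Q => Quotient.liftOn' Q (extMk u hu) (fun q q' h =>
      (extMk_eq_iff u hu q q').2 (QuotientAddGroup.leftRel_apply.1 h)))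
    ⟨by
      intro Q Q'
      induction Q using QuotientAddGroup.induction_on with
      | H q =>
      induction Q' using QuotientAddGroup.induction_on with
      | H q' =>
      intro h
      exact QuotientAddGroup.eq.2 ((extMk_eq_iff u hu q q').1 h), fun e => by
      obtain ⟨q, rfl⟩ := extMk_surjective u hu e
      exact ⟨QuotientAddGroup.mk q, rfl⟩⟩

/-- The group structure of the extension `E_{τ,b}`: that of the cokernel attached to a
representative of `b`. It does not depend on the representative, see `extMk_add`. -/
instance {d : ℕ} (τ : SiegelSpace d) (b : TorusB τ) : AddCommGroup (Extn τ b) :=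
  (fibreEquiv (Quotient.out b) (Quotient.out_eq' b)).symm.addCommGroup

theorem extMk_add {d : ℕ} {τ : SiegelSpace d} {b : TorusB τ} (u : Fin d → ℂ)
    (hu : QuotientAddGroup.mk u = b) (q q' : (Fin d → ℂ) × ℂ) :
    extMk u hu (q + q') = extMk u hu q + extMk u hu q' := by
  set u₀ : Fin d → ℂ := Quotient.out b with hu₀
  have hb : (QuotientAddGroup.mk u₀ : TorusB τ) = b := Quotient.out_eq' b
  have base : ∀ p p', extMk u₀ hb p + extMk u₀ hb p' = extMk u₀ hb (p + p') := by
    intro p p'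
    have h := ((fibreEquiv u₀ hb).symm_apply_apply (QuotientAddGroup.mk p))
    have h' := ((fibreEquiv u₀ hb).symm_apply_apply (QuotientAddGroup.mk p'))
    change fibreEquiv u₀ hb ((fibreEquiv u₀ hb).symm (fibreEquiv u₀ hb (QuotientAddGroup.mk p))
      + (fibreEquiv u₀ hb).symm (fibreEquiv u₀ hb (QuotientAddGroup.mk p'))) = _
    rw [h, h']
    rfl
  obtain ⟨_, ⟨n, rfl⟩, hn⟩ := (QuotientAddGroup.eq).1 (hu.trans hb.symm)
  have shift : ∀ p : (Fin d → ℂ) × ℂ, extMk u hu p = extMk u₀ hb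
      (p.1, p.2 + 2 * Real.pi * Complex.I * ((fun i => (n (Sum.inl i) : ℂ)) ⬝ᵥ p.1)) := by
    intro p
    refine Subtype.ext (Eq.symm ((pmk_eq_iff _ _).2 ⟨_, ⟨n, 0, 0, rfl⟩, ?_⟩))
    rw [smul_ofCoords]
    have e : u₀ = u + rowMap τ (castHom d n) := by rw [hn]; abel
    simp only [map_zero, add_zero, ← e]
    congr 1
    simp [castHom, dotProduct]
  rw [shift, shift, shift, base]
  congr 1
  refine Prod.ext rfl ?_
  simp only [Prod.fst_add, Prod.snd_add, dotProduct_add]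
  ring

/-- The unit section over `B_τ` of the Poincaré torsor. -/
def unitSection {d : ℕ} (τ : SiegelSpace d) (b : TorusB τ) : PoincareTorsor τ := (0 : Extn τ b).1

/-- The point of `E_{τ,x̄}` given by the class of `p_{z,y} p_x τ̃`, with `p_{z,y} = (1 0 z; 0 1 y; 0 0 1)`
and `p_x = (1 x 0; 0 1 0; 0 0 1)`. -/
def extPt {d : ℕ} (τ : SiegelSpace d) (x y : Idx d → ℝ) (z : ℂ) : Extn τ (toB τ x) :=
  ⟨pmk (((⟨0, y, z⟩ : Heis d) * rowElt x) • baseMHS τ), by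
    rw [baseMHS, smul_ofCoords, projB_pmk]
    simp [Heis.mul_def, rowElt, toB]⟩

/-- `Φ` is an isomorphism of real Lie groups from `(ℂ/2πiℤ) × (ℝ^{2d}/ℤ^{2d})` onto `E_{τ,x̄}`:
besides being an isomorphism of topological groups, it lifts to an isomorphism of real vector
spaces between the universal covers. -/
def IsRealLieIso {d : ℕ} {τ : SiegelSpace d} {x : Idx d → ℝ}
    (Φ : ((ℂ ⧸ AddSubgroup.zmultiples (2 * Real.pi * Complex.I : ℂ)) ×
      ((Idx d → ℝ) ⧸ intLattice d)) ≃ₜ+ Extn τ (toB τ x)) : Prop :=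
  ∃ L : (ℂ × (Idx d → ℝ)) ≃L[ℝ] ((Fin d → ℂ) × ℂ), ∀ (z : ℂ) (y : Idx d → ℝ),
    Φ (QuotientAddGroup.mk z, QuotientAddGroup.mk y) = extMk (rowMap τ x) rfl (L (z, y))

/-! ### The Ribet section -/

/-- A section of the Poincaré torsor over `B_τ` is holomorphic if locally on `M_{1,d}(ℂ)` it is
given by holomorphic functions `v`, `w` of `u`. -/
def IsHolomorphicSection {d : ℕ} {τ : SiegelSpace d} (r : ∀ b : TorusB τ, Extn τ b) : Prop :=
  ∀ u₀ : Fin d → ℂ, ∃ U : Set (Fin d → ℂ), IsOpen U ∧ u₀ ∈ U ∧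
    ∃ (v : (Fin d → ℂ) → (Fin d → ℂ)) (w : (Fin d → ℂ) → ℂ),
      DifferentiableOn ℂ v U ∧ DifferentiableOn ℂ w U ∧
      ∀ u ∈ U, r (QuotientAddGroup.mk u) = extMk u rfl (v u, w u)

/-- The Ribet section: a holomorphic section of the restriction of the Poincaré torsor to the graph
of `α : B_τ → A_τ` with value `1` at the origin, i.e. the unit of the fibre `ℂ^×` over `(0, 0)`. -/
structure IsRibetSection {d : ℕ} {τ : SiegelSpace d} (α : TorusHom τ)
    (r : ∀ b : TorusB τ, Extn τ b) : Prop where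
  holomorphic : IsHolomorphicSection r
  graph : ∀ b, projA τ (r b).1 = α.toHom b
  origin : r 0 = 0

end

end RibetMSV

open RibetMSV

/-! Everything is computed in real coordinates. Positivity of the imaginary part of τ makes `rowMap
τ` and `colMap τ` isomorphisms ℝ^{2d} ≅ ℂ^d of real vector spaces, and the group element (x, y, z)
sends τ̃ to the point u = `rowMap τ x`, v = `colMap τ y`, w = 2πi z - u·y₂ (`smul_baseMHS`). So
P^u(ℝ)U(ℂ) acts simply transitively on D_τ. At fixed x the same formula is real linear in (2πi z, y)
and matches the product lattice with the kernel `extLatA`; this uniformises the fibres.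

Duality forces the lattice matrix of f^∨ to be -f_ℤᵗ (`IsDual.matZ_eq`), so a = α_ℤ = f_ℤ + f_ℤᵗ is
symmetric. An integral matrix defines a morphism at τ when it maps the annihilator of M_τ^{0,-1}
into M_τ^{0,-1}. The relation g a gᵗ = μ a carries this property from τ₀ along the orbit
(`colLin_mulVec_eq_zero_of_mem_siegelOrbit`).

The Ribet section is x ↦ (x, a x, x f_ℤ xᵗ)·τ̃. Translating x by an integral n is left
multiplication by the integral element (n, a n, n f_ℤ nᵗ), because n a xᵗ = n f_ℤ xᵗ + x f_ℤ nᵗ;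
hence the section descends to B_τ (`extMk_ribetLift_congr`). Symmetry of a and the Hodge condition
turn its coordinate w into a quadratic form in u (`ribetW_rowMap`), so it is holomorphic. If n x is
integral, so is n² x f_ℤ xᵗ, whence the torsion statement. Two such sections over the same graph
differ by a nowhere zero holomorphic function on the compact torus B_τ, constant by Liouville and
equal to 1 at the origin (`IsRibetSection.eq_ribetSection`). -/

namespace RibetMSV

noncomputable section

/-! ### Complexified period maps -/

/-- A real vector viewed as a complex vector. -/
def castC {d : ℕ} (x : Idx d → ℝ) : Idx d → ℂ := fun i => (x i : ℂ)

/-- The complex-linear extension of `colMap τ`. -/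
def colLin {d : ℕ} (τ : SiegelSpace d) : (Idx d → ℂ) →ₗ[ℂ] (Fin d → ℂ) :=
  LinearMap.funLeft ℂ ℂ Sum.inl - Matrix.mulVecLin τ.1 ∘ₗ LinearMap.funLeft ℂ ℂ Sum.inr

/-- The complex-linear extension of `rowMap τ`, divided by `2πi`. -/
def rowLin {d : ℕ} (τ : SiegelSpace d) : (Idx d → ℂ) →ₗ[ℂ] (Fin d → ℂ) :=
  Matrix.mulVecLin τ.1 ∘ₗ LinearMap.funLeft ℂ ℂ Sum.inl + LinearMap.funLeft ℂ ℂ Sum.inr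

theorem colLin_apply {d : ℕ} (τ : SiegelSpace d) (N : Idx d → ℂ) :
    colLin τ N = (fun i => N (Sum.inl i)) - τ.1 *ᵥ (fun i => N (Sum.inr i)) := rfl

theorem rowLin_apply {d : ℕ} (τ : SiegelSpace d) (N : Idx d → ℂ) :
    rowLin τ N = τ.1 *ᵥ (fun i => N (Sum.inl i)) + (fun i => N (Sum.inr i)) := rfl

theorem vecMul_siegel {d : ℕ} (τ : SiegelSpace d) (s : Fin d → ℂ) : s ᵥ* τ.1 = τ.1 *ᵥ s := by
  conv_lhs => rw [← τ.2.1.eq]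
  exact vecMul_transpose _ _

theorem siegel_dotProduct_comm {d : ℕ} (τ : SiegelSpace d) (s t : Fin d → ℂ) :
    (τ.1 *ᵥ s) ⬝ᵥ t = s ⬝ᵥ (τ.1 *ᵥ t) := by
  rw [dotProduct_mulVec, vecMul_siegel]

theorem colMap_eq {d : ℕ} (τ : SiegelSpace d) (y : Idx d → ℝ) : colMap τ y = colLin τ (castC y) :=
  rfl

theorem rowMap_eq {d : ℕ} (τ : SiegelSpace d) (x : Idx d → ℝ) :
    rowMap τ x = (2 * Real.pi * Complex.I : ℂ) • rowLin τ (castC x) := by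
  rw [rowLin_apply, ← vecMul_siegel]; rfl

theorem castC_smul {d : ℕ} (c : ℝ) (y : Idx d → ℝ) : castC (c • y) = (c : ℂ) • castC y := by
  ext; exact Complex.ofReal_mul _ _

theorem colMap_smul {d : ℕ} (τ : SiegelSpace d) (c : ℝ) (y : Idx d → ℝ) :
    colMap τ (c • y) = c • colMap τ y := by
  rw [colMap_eq, colMap_eq, ← Complex.coe_smul, ← map_smul, castC_smul]

theorem rowMap_smul {d : ℕ} (τ : SiegelSpace d) (c : ℝ) (y : Idx d → ℝ) :
    rowMap τ (c • y) = c • rowMap τ y := by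
  rw [rowMap_eq, rowMap_eq, ← Complex.coe_smul, castC_smul, map_smul, smul_comm]

theorem colMap_injective {d : ℕ} (τ : SiegelSpace d) : Function.Injective (colMap τ) := by
  rw [injective_iff_map_eq_zero]
  intro y hy
  -- Since τ is symmetric, y₁ - τ y₂ is the row period x₁ τ + x₂ of x = (-y₂, y₁), so injectivity of
  -- `rowMap τ` applies.
  have h : (Sum.elim (fun i => -y (Sum.inr i)) (fun i => y (Sum.inl i)) : Idx d → ℝ) = 0 := by
    refine (map_eq_zero_iff (rowMap τ) (rowMap_injective τ)).1 ?_
    rw [rowMap_eq, rowLin_apply]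
    rw [colMap_eq, colLin_apply] at hy
    refine smul_eq_zero_of_right _ ?_
    rw [← hy, sub_eq_add_neg, add_comm, ← mulVec_neg]
    refine congrArg₂ _ rfl (congrArg _ ?_)
    ext i; simp [castC]
  ext (i | i)
  · simpa using congrFun h (Sum.inr i)
  · simpa using congrFun h (Sum.inl i)

theorem finrank_idx (d : ℕ) :
    Module.finrank ℝ (Idx d → ℝ) = Module.finrank ℝ (Fin d → ℂ) := by
  rw [Module.finrank_fintype_fun_eq_card, Module.finrank_pi_fintype]
  simp [Complex.finrank_real_complex]; ring

/-- `colMap τ` as an isomorphism of real vector spaces. -/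
def colEquiv {d : ℕ} (τ : SiegelSpace d) : (Idx d → ℝ) ≃L[ℝ] (Fin d → ℂ) :=
  (LinearMap.linearEquivOfInjective
    ({ (colMap τ) with map_smul' := colMap_smul τ } : (Idx d → ℝ) →ₗ[ℝ] (Fin d → ℂ))
    (colMap_injective τ) (finrank_idx d)).toContinuousLinearEquiv

/-- `rowMap τ` as an isomorphism of real vector spaces. -/
def rowEquiv {d : ℕ} (τ : SiegelSpace d) : (Idx d → ℝ) ≃L[ℝ] (Fin d → ℂ) :=
  (LinearMap.linearEquivOfInjective
    ({ (rowMap τ) with map_smul' := rowMap_smul τ } : (Idx d → ℝ) →ₗ[ℝ] (Fin d → ℂ))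
    (rowMap_injective τ) (finrank_idx d)).toContinuousLinearEquiv

theorem colEquiv_apply {d : ℕ} (τ : SiegelSpace d) (y : Idx d → ℝ) : colEquiv τ y = colMap τ y :=
  rfl

theorem rowEquiv_apply {d : ℕ} (τ : SiegelSpace d) (x : Idx d → ℝ) : rowEquiv τ x = rowMap τ x :=
  rfl

theorem exists_rowMap {d : ℕ} (τ : SiegelSpace d) (u : Fin d → ℂ) : ∃ x, rowMap τ x = u :=
  (rowEquiv τ).surjective u

theorem toB_surjective {d : ℕ} (τ : SiegelSpace d) : Function.Surjective (toB τ) := by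
  intro b
  induction b using QuotientAddGroup.induction_on with
  | H u =>
  obtain ⟨x, rfl⟩ := exists_rowMap τ u
  exact ⟨x, rfl⟩

theorem colLin_eq_zero_iff {d : ℕ} (τ : SiegelSpace d) (N : Idx d → ℂ) :
    colLin τ N = 0 ↔ N ∈ hodgeSub τ := by
  rw [colLin_apply, sub_eq_zero]
  constructor
  · intro h
    refine ⟨fun i => N (Sum.inr i), ?_⟩
    rw [← h]; ext (i | i) <;> rfl
  · rintro ⟨s, rfl⟩
    rfl

theorem dotProduct_idx {d : ℕ} {R : Type*} [CommSemiring R] (N M : Idx d → R) :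
    N ⬝ᵥ M = (fun i => N (Sum.inl i)) ⬝ᵥ (fun i => M (Sum.inl i)) +
      (fun i => N (Sum.inr i)) ⬝ᵥ (fun i => M (Sum.inr i)) := by
  simp [dotProduct, Fintype.sum_sum_type]

/-- The natural pairing in terms of the two period maps. -/
theorem pairing_eq {d : ℕ} (τ : SiegelSpace d) (N M : Idx d → ℂ) :
    N ⬝ᵥ M = (fun i => N (Sum.inl i)) ⬝ᵥ colLin τ M +
      rowLin τ N ⬝ᵥ (fun i => M (Sum.inr i)) := by
  rw [dotProduct_idx, colLin_apply, rowLin_apply, dotProduct_sub, add_dotProduct,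
    siegel_dotProduct_comm]
  ring

/-- Against a vector of M_τ^{0,-1}, only the term `rowLin τ N` · M₂ of `pairing_eq` survives, and M₂
is arbitrary. This intrinsic description of the kernel is what can be transported by g. -/
theorem rowLin_eq_zero_iff {d : ℕ} (τ : SiegelSpace d) (N : Idx d → ℂ) :
    rowLin τ N = 0 ↔ ∀ M ∈ hodgeSub τ, N ⬝ᵥ M = 0 := by
  constructor
  · intro h M hM
    rw [pairing_eq τ, h, (colLin_eq_zero_iff τ M).2 hM]
    simp
  · intro h
    refine dotProduct_eq_zero _ fun s => ?_
    have := h (Sum.elim (τ.1 *ᵥ s) s) ⟨s, rfl⟩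
    rw [pairing_eq τ, (colLin_eq_zero_iff τ _).2 ⟨s, rfl⟩] at this
    simpa using this

theorem castC_dotProduct {d : ℕ} (x y : Idx d → ℝ) : ((x ⬝ᵥ y : ℝ) : ℂ) = castC x ⬝ᵥ castC y := by
  simp [castC, dotProduct]

/-- An integral matrix with complex entries. -/
abbrev cplxMat {d : ℕ} (a : Matrix (Idx d) (Idx d) ℤ) : Matrix (Idx d) (Idx d) ℂ :=
  a.map (Int.cast : ℤ → ℂ)

/-- An integral matrix with real entries. -/
abbrev realMat {d : ℕ} (a : Matrix (Idx d) (Idx d) ℤ) : Matrix (Idx d) (Idx d) ℝ :=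
  a.map (Int.cast : ℤ → ℝ)

theorem castC_mulVec {d : ℕ} (a : Matrix (Idx d) (Idx d) ℤ) (x : Idx d → ℝ) :
    castC (realMat a *ᵥ x) = cplxMat a *ᵥ castC x := by
  ext i; simp [castC, mulVec, dotProduct]

theorem castHom_mulVec {d : ℕ} (a : Matrix (Idx d) (Idx d) ℤ) (n : Idx d → ℤ) :
    castHom d (a *ᵥ n) = realMat a *ᵥ castHom d n := by
  ext i; simp [castHom, mulVec, dotProduct]

theorem castHom_single {d : ℕ} (i : Idx d) :
    castC (castHom d (Pi.single i 1)) = Pi.single i 1 := by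
  ext j
  by_cases h : j = i
  · subst h; simp [castC, castHom]
  · simp [castC, castHom, h]

/-- The commutation of a morphism of tori with the lattice map, on complex vectors. -/
theorem TorusHom.comm_complex {d : ℕ} {τ : SiegelSpace d} (f : TorusHom τ) (N : Idx d → ℂ) :
    f.matC *ᵥ ((2 * Real.pi * Complex.I : ℂ) • rowLin τ N) = colLin τ (cplxMat f.matZ *ᵥ N) := by
  have h : (Matrix.mulVecLin f.matC) ∘ₗ ((2 * Real.pi * Complex.I : ℂ) • rowLin τ) =
      colLin τ ∘ₗ Matrix.mulVecLin (cplxMat f.matZ) := by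
    -- Both sides are complex linear, so it suffices to compare them on the standard basis, which is
    -- integral.
    refine LinearMap.pi_ext' fun i => LinearMap.ext_ring ?_
    have := f.comm (Pi.single i 1)
    rw [rowMap_eq, colMap_eq, castHom_mulVec, castC_mulVec, castHom_single] at this
    exact this
  exact LinearMap.congr_fun h N

theorem TorusHom.comm_real {d : ℕ} {τ : SiegelSpace d} (f : TorusHom τ) (x : Idx d → ℝ) :
    f.matC *ᵥ rowMap τ x = colMap τ (realMat f.matZ *ᵥ x) := by
  rw [rowMap_eq, f.comm_complex, colMap_eq, castC_mulVec]

/-- `n₁ · colMap y + (2πi)⁻¹ rowMap n · y₂ = n · y`. -/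
theorem pairing_real {d : ℕ} (τ : SiegelSpace d) (x y : Idx d → ℝ) :
    2 * Real.pi * Complex.I * ((x ⬝ᵥ y : ℝ) : ℂ) =
      2 * Real.pi * Complex.I * ((fun i => (x (Sum.inl i) : ℂ)) ⬝ᵥ colMap τ y) +
        rowMap τ x ⬝ᵥ (fun i => (y (Sum.inr i) : ℂ)) := by
  rw [castC_dotProduct, pairing_eq τ, rowMap_eq, colMap_eq, smul_dotProduct, smul_eq_mul, mul_add]
  rfl

/-! ### The dual morphism -/

theorem eq_zero_of_real_valued {V : Type*} [AddCommGroup V] [Module ℂ V] (l : V →ₗ[ℂ] ℂ)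
    (h : ∀ v, (l v).im = 0) : l = 0 := by
  ext v
  have h1 := h (Complex.I • v)
  simp only [map_smul, smul_eq_mul, Complex.mul_im, Complex.I_re, zero_mul, Complex.I_im, one_mul,
    zero_add] at h1
  exact Complex.ext h1 (h v)

/-- The imaginary part is real linear and the lattice spans ℂ^d over ℝ, so `l` takes only real
values; a complex linear form with real values is zero. -/
theorem im_eq_zero_of_lattice {d : ℕ} (τ : SiegelSpace d) (l : (Fin d → ℂ) →ₗ[ℂ] ℂ)
    (h : ∀ n : Idx d → ℤ, (l (rowMap τ (castHom d n))).im = 0) : l = 0 := by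
  have key : Complex.imLm ∘ₗ l.restrictScalars ℝ ∘ₗ (rowEquiv τ).toLinearEquiv.toLinearMap = 0 := by
    refine LinearMap.pi_ext' fun i => LinearMap.ext_ring ?_
    have := h (Pi.single i 1)
    have e : castHom d (Pi.single i 1) = Pi.single i 1 := by
      ext j
      by_cases hj : j = i
      · subst hj; simp [castHom]
      · simp [castHom, hj]
    rw [e] at this
    exact this
  refine eq_zero_of_real_valued l fun u => ?_
  obtain ⟨x, rfl⟩ := exists_rowMap τ u
  exact LinearMap.congr_fun key x

theorem eq_zero_of_dotProduct_int {d : ℕ} (y : Idx d → ℝ)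
    (h : ∀ x : Idx d → ℝ, ∃ k : ℤ, x ⬝ᵥ y = k) : y = 0 := by
  ext i
  by_contra hne
  -- This vector pairs with y to 1/2, which is not an integer.
  obtain ⟨k, hk⟩ := h (Pi.single i (2 * y i)⁻¹)
  rw [single_dotProduct] at hk
  have hne' : y i ≠ 0 := hne
  have h2 : (1 : ℝ) = 2 * k := by rw [← hk]; field_simp
  have : (1 : ℤ) = 2 * k := by exact_mod_cast h2
  omega

/-- A morphism of extensions that is the identity on ℂ^× is determined by a linear form on ℂ^d.
Compatibility with the lattices fixes that form modulo integers on lattice vectors, and complex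
linearity leaves no freedom for it. -/
theorem IsDual.pairing_int {d : ℕ} {τ : SiegelSpace d} {f g : TorusHom τ} (h : IsDual f g)
    (x : Idx d → ℝ) (n : Idx d → ℤ) :
    ∃ k : ℤ, castHom d n ⬝ᵥ (realMat g.matZ *ᵥ x) + x ⬝ᵥ (realMat f.matZ *ᵥ castHom d n) = k := by
  obtain ⟨ψ, hψ1, hψ2, hψ3⟩ := h (rowMap τ x)
  have hpi : (2 * Real.pi * Complex.I : ℂ) ≠ 0 := Complex.two_pi_I_ne_zero
  let gx := realMat g.matZ *ᵥ x
  -- The ℂ-component of ψ, corrected by the non-integral terms that `pairing_real` produces for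
  -- n·(gx) and x·(fn). With this choice `m` is still complex linear, and on lattice vectors it is
  -- an integer minus a real number.
  let m : (Fin d → ℂ) →ₗ[ℂ] ℂ :=
    { toFun := fun u => (2 * Real.pi * Complex.I : ℂ)⁻¹ * ((ψ (u, 0)).2 -
        u ⬝ᵥ (fun i => (gx (Sum.inr i) : ℂ))) -
        (fun i => (x (Sum.inl i) : ℂ)) ⬝ᵥ (f.matC *ᵥ u)
      map_add' := fun u u' => by
        have : ((u + u', 0) : (Fin d → ℂ) × ℂ) = (u, 0) + (u', 0) := by simp
        rw [this, map_add, Prod.snd_add, mulVec_add, dotProduct_add, add_dotProduct]; ring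
      map_smul' := fun c u => by
        have : ((c • u, 0) : (Fin d → ℂ) × ℂ) = c • (u, 0) := by simp
        rw [this, map_smul, Prod.smul_snd, mulVec_smul, dotProduct_smul, smul_dotProduct]
        simp only [smul_eq_mul, RingHom.id_apply]; ring }
  have key : ∀ n : Idx d → ℤ, ∃ k : ℤ, m (rowMap τ (castHom d n)) +
      ((castHom d n ⬝ᵥ gx + x ⬝ᵥ (realMat f.matZ *ᵥ castHom d n) : ℝ) : ℂ) = k := by
    intro n
    -- The lattice vectors with k = 0 suffice, since ψ is the identity on ℤ(1).
    obtain ⟨k, n', hk⟩ := hψ3 _ ⟨0, n, rfl⟩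
    have h1 := congrArg Prod.fst hk
    have h2 := congrArg Prod.snd hk
    simp only [hψ2] at h1
    rw [f.comm_real, ← castHom_mulVec] at h1
    have hn := colMap_injective τ h1
    rw [g.comm_real] at h2
    have hsplit : ∀ w : ℂ, (ψ (rowMap τ (castHom d n), w)).2 =
        (ψ (rowMap τ (castHom d n), 0)).2 + w := by
      intro w
      have : ((rowMap τ (castHom d n), w) : (Fin d → ℂ) × ℂ) =
        (rowMap τ (castHom d n), 0) + (0, w) := by simp
      rw [this, map_add, Prod.snd_add, hψ1]
    rw [hsplit] at h2
    refine ⟨k, ?_⟩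
    refine mul_left_cancel₀ hpi ?_
    have p1 := pairing_real τ (castHom d n) gx
    have p2 := pairing_real τ x (realMat f.matZ *ᵥ castHom d n)
    rw [← f.comm_real, ← castHom_mulVec, hn] at p2
    rw [← castHom_mulVec, hn]
    simp only [m, LinearMap.coe_mk, AddHom.coe_mk]
    push_cast
    rw [mul_add, mul_add, p1, p2, mul_sub, mul_inv_cancel_left₀ hpi]
    simp only [castHom, AddMonoidHom.coe_mk, ZeroHom.coe_mk, Complex.ofReal_intCast] at h2 ⊢
    linear_combination h2
  have hm : m = 0 := im_eq_zero_of_lattice τ m fun n => by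
    obtain ⟨k, hk⟩ := key n
    have := congrArg Complex.im hk
    simpa using this
  obtain ⟨k, hk⟩ := key n
  rw [hm] at hk
  refine ⟨k, ?_⟩
  simp only [LinearMap.zero_apply, zero_add] at hk
  exact_mod_cast hk

/-- The integral matrix of the dual morphism. -/
theorem IsDual.matZ_eq {d : ℕ} {τ : SiegelSpace d} {f g : TorusHom τ} (h : IsDual f g) :
    g.matZ = -f.matZᵀ := by
  have key : ∀ n : Idx d → ℤ, (realMat g.matZ)ᵀ *ᵥ castHom d n + realMat f.matZ *ᵥ castHom d n = 0 := by
    intro n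
    -- The row x is an arbitrary real vector, so integrality of the pairing for every x forces the
    -- other factor to vanish.
    refine eq_zero_of_dotProduct_int _ fun x => ?_
    obtain ⟨k, hk⟩ := h.pairing_int x n
    refine ⟨k, ?_⟩
    rw [← hk, dotProduct_add, dotProduct_mulVec x, vecMul_transpose, dotProduct_comm]
  ext i j
  have h1 := congrFun (key (Pi.single i 1)) j
  have e : castHom d (Pi.single i 1) = Pi.single i 1 := by
    ext k
    by_cases hk : k = i
    · subst hk; simp [castHom]
    · simp [castHom, hk]
  rw [e, mulVec_single_one, mulVec_single_one] at h1
  simp only [Pi.add_apply, col_apply, transpose_apply, map_apply, Pi.zero_apply] at h1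
  have h2 : g.matZ i j + f.matZ j i = 0 := by exact_mod_cast h1
  simp only [neg_apply, transpose_apply]
  omega

/-! ### Transport of `α` along the orbit -/

/-- On the orbit, `a` maps the annihilator of `M_τ^{0,-1}` into `M_τ^{0,-1}`. -/
theorem colLin_mulVec_eq_zero_of_mem_siegelOrbit {d : ℕ} {τ₀ τ : SiegelSpace d} (α : TorusHom τ₀)
    (hτ : τ ∈ siegelOrbit τ₀ α.matZ) (N : Idx d → ℂ) (hN : rowLin τ N = 0) :
    colLin τ (cplxMat α.matZ *ᵥ N) = 0 := by
  obtain ⟨⟨⟨g, μ⟩, _, hg⟩, _, hM⟩ := hτ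
  simp only at hg hM
  set gC : Matrix (Idx d) (Idx d) ℂ := g.1.map Complex.ofReal with hgC
  -- The stabiliser condition in congruence form, g a gᵗ = μ a.
  have hconj : gC * cplxMat α.matZ * gCᵀ = (μ.1 : ℂ) • cplxMat α.matZ := by
    have h1 : g.1 * realMat α.matZ * g.1ᵀ = μ.1 • realMat α.matZ := by
      have : ((g⁻¹).1)ᵀ * g.1ᵀ = 1 := by rw [← transpose_mul]; simp
      rw [hg, Matrix.smul_mul, Matrix.mul_assoc, this, Matrix.mul_one]
    have h2 := congrArg (fun A : Matrix (Idx d) (Idx d) ℝ => A.map Complex.ofRealHom) h1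
    simp only [Matrix.map_mul] at h2
    have e1 : (realMat α.matZ).map Complex.ofRealHom = cplxMat α.matZ := by ext; simp
    have e2 : (μ.1 • realMat α.matZ).map Complex.ofRealHom = (μ.1 : ℂ) • cplxMat α.matZ := by
      ext; simp
    rw [e1, e2] at h2
    exact h2
  -- The transpose of g carries the annihilator of gM into the annihilator of M. Then a maps into M
  -- by the morphism at τ₀, and g maps back into gM.
  have hN' : rowLin τ₀ (gCᵀ *ᵥ N) = 0 := by
    rw [rowLin_eq_zero_iff] at hN ⊢
    intro M hMm
    have := hN (gC *ᵥ M) (hM ▸ ⟨M, hMm, rfl⟩)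
    rwa [mulVec_transpose, ← dotProduct_mulVec]
  have h0 := α.comm_complex (gCᵀ *ᵥ N)
  rw [hN', smul_zero, mulVec_zero] at h0
  have h1 : gC *ᵥ (cplxMat α.matZ *ᵥ (gCᵀ *ᵥ N)) ∈ hodgeSub τ :=
    hM ▸ ⟨_, (colLin_eq_zero_iff τ₀ _).1 h0.symm, rfl⟩
  rw [mulVec_mulVec, mulVec_mulVec, hconj, smul_mulVec] at h1
  have hμ : (μ.1 : ℂ) ≠ 0 := by exact_mod_cast μ.ne_zero
  exact (colLin_eq_zero_iff τ _).2 ((Submodule.smul_mem_iff _ hμ).1 h1)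

/-- The vector `(0, s)`. -/
def inrVec {d : ℕ} : (Fin d → ℂ) →ₗ[ℂ] (Idx d → ℂ) where
  toFun s := Sum.elim 0 s
  map_add' s t := by ext (i | i) <;> simp
  map_smul' c t := by ext (i | i) <;> simp

theorem rowLin_inrVec {d : ℕ} (τ : SiegelSpace d) (s : Fin d → ℂ) : rowLin τ (inrVec s) = s := by
  rw [rowLin_apply]
  change τ.1 *ᵥ (0 : Fin d → ℂ) + s = s
  simp

/-- The morphism `B_τ → A_τ` with given matrix on the lattices. -/
def torusHomOfMat {d : ℕ} (τ : SiegelSpace d) (a : Matrix (Idx d) (Idx d) ℤ)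
    (h : ∀ N : Idx d → ℂ, rowLin τ N = 0 → colLin τ (cplxMat a *ᵥ N) = 0) : TorusHom τ where
  -- `inrVec` is a complex linear right inverse of `rowLin τ`. By `h`, any other lift of the same
  -- vector has the same image.
  matC := LinearMap.toMatrix' ((2 * Real.pi * Complex.I : ℂ)⁻¹ •
    (colLin τ ∘ₗ Matrix.mulVecLin (cplxMat a) ∘ₗ inrVec))
  matZ := a
  comm n := by
    rw [← Matrix.toLin'_apply, Matrix.toLin'_toMatrix', rowMap_eq, castHom_mulVec, colMap_eq,
      castC_mulVec, LinearMap.smul_apply, map_smul, smul_smul,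
      inv_mul_cancel₀ Complex.two_pi_I_ne_zero, one_smul]
    simp only [LinearMap.comp_apply, Matrix.mulVecLin_apply]
    rw [← sub_eq_zero, ← map_sub, ← mulVec_sub]
    refine h _ ?_
    rw [map_sub, rowLin_inrVec, sub_self]

/-! ### The coordinates of the Ribet section -/

/-- The third coordinate of the Ribet section attached to a symmetric `a`. -/
def ribetW {d : ℕ} (a : Matrix (Idx d) (Idx d) ℤ) (u : Fin d → ℂ) : ℂ :=
  -(4 * Real.pi * Complex.I : ℂ)⁻¹ * (inrVec u ⬝ᵥ (cplxMat a *ᵥ inrVec u))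

theorem ribetW_differentiable {d : ℕ} (a : Matrix (Idx d) (Idx d) ℤ) :
    Differentiable ℂ (ribetW (d := d) a) := by
  have h1 : Differentiable ℂ (fun u : Fin d → ℂ => inrVec u) :=
    (LinearMap.toContinuousLinearMap (inrVec (d := d))).differentiable
  have h2 : Differentiable ℂ (fun u : Fin d → ℂ => cplxMat a *ᵥ inrVec u) :=
    (LinearMap.toContinuousLinearMap (Matrix.mulVecLin (cplxMat a) ∘ₗ inrVec)).differentiable
  unfold ribetW dotProduct
  refine Differentiable.const_mul ?_ _
  refine Differentiable.fun_sum fun i _ => ?_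
  exact (differentiable_pi.1 h1 i).mul (differentiable_pi.1 h2 i)

theorem dotProduct_mulVec_symm {d : ℕ} {R : Type*} [CommRing R] {a : Matrix (Idx d) (Idx d) R}
    (ha : aᵀ = a) (P Q : Idx d → R) : P ⬝ᵥ (a *ᵥ Q) = Q ⬝ᵥ (a *ᵥ P) := by
  rw [dotProduct_mulVec, ← mulVec_transpose, ha, dotProduct_comm]

/-- In terms of real coordinates, `w = πi x a xᵗ - u · (a x)₂`. -/
theorem ribetW_rowMap {d : ℕ} {τ : SiegelSpace d} (α : TorusHom τ) (hα : α.matZᵀ = α.matZ)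
    (x : Idx d → ℝ) :
    ribetW α.matZ (rowMap τ x) = Real.pi * Complex.I * ((x ⬝ᵥ (realMat α.matZ *ᵥ x) : ℝ) : ℂ) -
      rowMap τ x ⬝ᵥ (fun i => ((realMat α.matZ *ᵥ x) (Sum.inr i) : ℂ)) := by
  have hpi : (2 * Real.pi * Complex.I : ℂ) ≠ 0 := Complex.two_pi_I_ne_zero
  have hpi2 : (Real.pi : ℂ) ≠ 0 := by exact_mod_cast Real.pi_ne_zero
  have hs : (cplxMat α.matZ)ᵀ = cplxMat α.matZ := by rw [← transpose_map, hα]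
  -- Write x = N + Q with Q = (0, u/2πi) and N annihilating M_τ^{0,-1}. Only the QaQ term will
  -- remain, which is holomorphic in u.
  set Q := inrVec (rowLin τ (castC x)) with hQ
  set N := castC x - Q with hN
  have hN0 : rowLin τ N = 0 := by rw [hN, map_sub, hQ, rowLin_inrVec, sub_self]
  have hx : castC x = N + Q := by rw [hN]; abel
  have hinr : inrVec (rowMap τ x) = (2 * Real.pi * Complex.I : ℂ) • Q := by
    rw [rowMap_eq, map_smul]
  -- The vector aN lies in M_τ^{0,-1}, which N annihilates. This isotropy removes the term not
  -- expressible through u.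
  have hNN : N ⬝ᵥ (cplxMat α.matZ *ᵥ N) = 0 := by
    rw [rowLin_eq_zero_iff] at hN0
    refine hN0 _ ((colLin_eq_zero_iff τ _).1 ?_)
    rw [← α.comm_complex, hN, map_sub, hQ, rowLin_inrVec, sub_self, smul_zero, mulVec_zero]
  have hQd : ∀ M : Idx d → ℂ, rowLin τ (castC x) ⬝ᵥ (fun i => M (Sum.inr i)) = Q ⬝ᵥ M := by
    intro M
    rw [dotProduct_idx, hQ]
    change _ = (0 : Fin d → ℂ) ⬝ᵥ _ + rowLin τ (castC x) ⬝ᵥ _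
    rw [zero_dotProduct, zero_add]
  have h3 : rowMap τ x ⬝ᵥ (fun i => ((realMat α.matZ *ᵥ x) (Sum.inr i) : ℂ)) =
      2 * Real.pi * Complex.I * (Q ⬝ᵥ (cplxMat α.matZ *ᵥ castC x)) := by
    rw [← hQd, ← castC_mulVec, rowMap_eq, smul_dotProduct, smul_eq_mul]; rfl
  rw [h3, castC_dotProduct, castC_mulVec, ribetW, hinr, hx, mulVec_smul, smul_dotProduct,
    dotProduct_smul, mulVec_add, dotProduct_add, dotProduct_add, add_dotProduct, add_dotProduct, hNN,
    dotProduct_mulVec_symm hs N Q]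
  simp only [smul_eq_mul]
  field_simp
  ring

/-! ### The orbit of `τ̃` -/

theorem smul_baseMHS {d : ℕ} (τ : SiegelSpace d) (p : Heis d) :
    p • baseMHS τ = ofCoords τ (rowMap τ p.x) (colMap τ p.y)
      (2 * Real.pi * Complex.I * p.z - rowMap τ p.x ⬝ᵥ (fun i => (p.y (Sum.inr i) : ℂ))) := by
  rw [baseMHS, smul_ofCoords]
  simp

theorem bijective_smul_baseMHS {d : ℕ} (τ : SiegelSpace d) :
    Function.Bijective (fun p : Heis d => p • baseMHS τ) := by
  have hpi : (2 * Real.pi * Complex.I : ℂ) ≠ 0 := Complex.two_pi_I_ne_zero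
  constructor
  · intro p q h
    simp only [smul_baseMHS] at h
    obtain ⟨h1, h2, h3⟩ := ofCoords_injective τ h
    have hx := rowMap_injective τ h1
    have hy := colMap_injective τ h2
    rw [hx, hy, sub_left_inj] at h3
    exact Heis.ext hx hy (mul_left_cancel₀ hpi h3)
  · intro F
    obtain ⟨u, v, w, rfl⟩ := ofCoords_surjective τ F
    obtain ⟨x, rfl⟩ := exists_rowMap τ u
    obtain ⟨y, hy⟩ := (colEquiv τ).surjective v
    rw [colEquiv_apply] at hy
    subst hy
    refine ⟨⟨x, y, (2 * Real.pi * Complex.I)⁻¹ *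
      (w + rowMap τ x ⬝ᵥ (fun i => (y (Sum.inr i) : ℂ)))⟩, ?_⟩
    simp only [smul_baseMHS]
    rw [mul_inv_cancel_left₀ hpi, add_sub_cancel_right]

theorem bijective_orbitMap {d : ℕ} (τ : SiegelSpace d) : Function.Bijective (orbitMap τ) := by
  constructor
  · intro P Q h
    induction P using Quotient.inductionOn with
    | h p =>
    induction Q using Quotient.inductionOn with
    | h q =>
    obtain ⟨r, hr, h⟩ := (pmk_eq_iff _ _).1 (h : pmk (p • baseMHS τ) = pmk (q • baseMHS τ))
    rw [smul_smul] at h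
    refine Quotient.sound (MulAction.orbitRel_apply.2 ⟨⟨r, hr⟩, ?_⟩)
    exact (bijective_smul_baseMHS τ).1 h
  · intro P
    induction P using Quotient.inductionOn with
    | h F =>
    obtain ⟨p, rfl⟩ := (bijective_smul_baseMHS τ).2 F
    exact ⟨hmk p, rfl⟩

/-! ### The fibres as quotient groups, and the unit section -/

theorem extMk_zero {d : ℕ} {τ : SiegelSpace d} {b : TorusB τ} (u : Fin d → ℂ)
    (hu : QuotientAddGroup.mk u = b) : extMk u hu (0 : (Fin d → ℂ) × ℂ) = 0 := by
  have := extMk_add u hu 0 0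
  rw [add_zero] at this
  exact left_eq_add.1 this

/-- The group homomorphism `M_{d,1}(ℂ) ⊕ ℂ → E_{τ,b}` attached to a representative of `b`. -/
def extHom {d : ℕ} {τ : SiegelSpace d} {b : TorusB τ} (u : Fin d → ℂ)
    (hu : QuotientAddGroup.mk u = b) : ((Fin d → ℂ) × ℂ) →+ Extn τ b where
  toFun := extMk u hu
  map_zero' := extMk_zero u hu
  map_add' := extMk_add u hu

theorem extHom_eq_zero_iff {d : ℕ} {τ : SiegelSpace d} {b : TorusB τ} (u : Fin d → ℂ)
    (hu : QuotientAddGroup.mk u = b) (q : (Fin d → ℂ) × ℂ) :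
    extHom u hu q = 0 ↔ q ∈ extLatA τ u := by
  rw [← extMk_zero u hu, eq_comm]
  refine (extMk_eq_iff u hu 0 q).trans ?_
  rw [neg_zero, zero_add]

theorem extMk_val {d : ℕ} {τ : SiegelSpace d} {b : TorusB τ} (x y : Idx d → ℝ) (z : ℂ)
    (hu : QuotientAddGroup.mk (rowMap τ x) = b) :
    (extMk (rowMap τ x) hu (colMap τ y,
      2 * Real.pi * Complex.I * z - rowMap τ x ⬝ᵥ (fun i => (y (Sum.inr i) : ℂ)))).1 =
      pmk ((⟨x, y, z⟩ : Heis d) • baseMHS τ) := by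
  rw [smul_baseMHS]; rfl

theorem orbitMap_rowElt {d : ℕ} (τ : SiegelSpace d) (x : Idx d → ℝ) :
    orbitMap τ (hmk (rowElt x)) = unitSection τ (toB τ x) := by
  have h := extMk_val (τ := τ) (b := toB τ x) x 0 0 rfl
  rw [unitSection, ← extMk_zero (τ := τ) (b := toB τ x) (rowMap τ x) rfl]
  change pmk ((⟨x, 0, 0⟩ : Heis d) • baseMHS τ) = _
  rw [← h]
  congr 2
  refine Prod.ext (map_zero _) ?_
  simp [dotProduct]

theorem image_orbitMap_rowElt {d : ℕ} (τ : SiegelSpace d) :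
    orbitMap τ '' Set.range (fun x : Idx d → ℝ => hmk (rowElt x)) =
      Set.range (unitSection τ) := by
  rw [← Set.range_comp, ← (toB_surjective τ).range_comp (unitSection τ)]
  exact congrArg _ (funext fun x => orbitMap_rowElt τ x)

/-! ### Topology of the fibres -/

theorem continuous_ofCoords {d : ℕ} (τ : SiegelSpace d) :
    Continuous (fun q : (Fin d → ℂ) × (Fin d → ℂ) × ℂ => ofCoords τ q.1 q.2.1 q.2.2) := by
  refine continuous_induced_rng.2 ?_
  convert continuous_id using 1
  funext q
  exact (coords τ).symm_apply_apply q

/-- The coordinates of `D_τ` as a homeomorphism. -/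
def coordsHomeo {d : ℕ} (τ : SiegelSpace d) :
    ((Fin d → ℂ) × (Fin d → ℂ) × ℂ) ≃ₜ MHS τ where
  toEquiv := coords τ
  continuous_toFun := continuous_ofCoords τ
  continuous_invFun := continuous_induced_dom

/-- In coordinates each group element acts by an affine map. Continuity of the action is what makes
the quotient map `pmk` open. -/
instance {d : ℕ} (τ : SiegelSpace d) : ContinuousConstSMul (Heis d) (MHS τ) where
  continuous_const_smul p := by
    rw [← (coordsHomeo τ).comp_continuous_iff']
    have : (fun F : MHS τ => p • F) ∘ coordsHomeo τ = coordsHomeo τ ∘ fun q =>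
        (q.1 + rowMap τ p.x, q.2.1 + colMap τ p.y,
        q.2.2 + 2 * Real.pi * Complex.I * ((fun i => (p.x (Sum.inl i) : ℂ)) ⬝ᵥ q.2.1)
        + 2 * Real.pi * Complex.I * p.z
        - (q.1 + rowMap τ p.x) ⬝ᵥ (fun i => (p.y (Sum.inr i) : ℂ))) := by
      funext q
      exact smul_ofCoords p τ q.1 q.2.1 q.2.2
    rw [this]
    refine (coordsHomeo τ).continuous.comp ?_
    unfold dotProduct
    fun_prop

instance {d : ℕ} (τ : SiegelSpace d) : ContinuousConstSMul (heisInt d) (MHS τ) where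
  continuous_const_smul p := continuous_const_smul (p : Heis d)

theorem continuous_pmk {d : ℕ} (τ : SiegelSpace d) :
    Continuous (pmk : MHS τ → PoincareTorsor τ) := continuous_quotient_mk'

theorem isOpenMap_pmk {d : ℕ} (τ : SiegelSpace d) : IsOpenMap (pmk : MHS τ → PoincareTorsor τ) :=
  isOpenMap_quotient_mk'_mul

theorem continuous_extMk {d : ℕ} {τ : SiegelSpace d} {b : TorusB τ} (u : Fin d → ℂ)
    (hu : QuotientAddGroup.mk u = b) : Continuous (extMk (τ := τ) u hu) := by
  have h : Continuous fun q : (Fin d → ℂ) × ℂ => ((u, q.1, q.2) : (Fin d → ℂ) × (Fin d → ℂ) × ℂ) :=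
    continuous_const.prodMk (continuous_fst.prodMk continuous_snd)
  have h2 : Continuous fun q : (Fin d → ℂ) × ℂ => ofCoords τ u q.1 q.2 := by
    have e : (fun q : (Fin d → ℂ) × ℂ => ofCoords τ u q.1 q.2) =
        coordsHomeo τ ∘ fun q => (u, q.1, q.2) := rfl
    rw [e]
    exact (coordsHomeo τ).continuous.comp h
  have h3 : Continuous fun q : (Fin d → ℂ) × ℂ => pmk (ofCoords τ u q.1 q.2) :=
    (continuous_pmk τ).comp h2
  exact h3.subtype_mk fun q => (projB_pmk τ u q.1 q.2).trans hu

theorem castHom_eq_zero_of_norm_lt {d : ℕ} (n : Idx d → ℤ) (h : ‖castHom d n‖ < 1) : n = 0 := by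
  ext i
  have h1 : |(n i : ℝ)| < 1 := (norm_le_pi_norm (castHom d n) i).trans_lt h
  have h2 : |n i| < 1 := by exact_mod_cast h1
  exact Int.abs_lt_one_iff.1 h2

/-- The subspace topology of the fibre must agree with the quotient topology of the cokernel. An
open set V at fixed u is thickened in the direction of u, so little that no other representative of
b enters; the image of the thickening in the torsor is open and meets the fibre exactly in the image
of V. -/
theorem isOpenMap_extMk {d : ℕ} {τ : SiegelSpace d} {b : TorusB τ} (u : Fin d → ℂ)
    (hu : QuotientAddGroup.mk u = b) : IsOpenMap (extMk (τ := τ) u hu) := by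
  intro V hV
  -- A neighbourhood of u in which no point differs from u by a nonzero lattice vector: such a
  -- vector has sup norm at least 1 in real coordinates.
  let O : Set (Fin d → ℂ) := {u' | ‖(rowEquiv τ).symm (u' - u)‖ < 1}
  have hO : IsOpen O := by
    refine isOpen_lt ?_ continuous_const
    exact ((rowEquiv τ).symm.continuous.comp (continuous_id.sub continuous_const)).norm
  have hopen : IsOpen (pmk '' (coordsHomeo τ '' (O ×ˢ V))) :=
    isOpenMap_pmk τ _ ((coordsHomeo τ).isOpenMap _ (hO.prod hV))
  refine isOpen_induced_iff.2 ⟨_, hopen, ?_⟩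
  ext e
  constructor
  · rintro ⟨_, ⟨⟨u', v, w⟩, ⟨hu', hq⟩, rfl⟩, he⟩
    have hb : (QuotientAddGroup.mk u : TorusB τ) = QuotientAddGroup.mk u' := by
      rw [hu, ← projB_pmk τ u' v w, ← e.2]
      exact congrArg _ he.symm
    obtain ⟨_, ⟨n, rfl⟩, hn⟩ := (QuotientAddGroup.eq).1 hb
    have hn' : rowEquiv τ (castHom d n) = u' - u := by
      rw [rowEquiv_apply, hn]; abel
    have hn0 : n = 0 := by
      refine castHom_eq_zero_of_norm_lt n ?_
      have : ‖(rowEquiv τ).symm (u' - u)‖ < 1 := hu'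
      rwa [← hn', ContinuousLinearEquiv.symm_apply_apply] at this
    rw [hn0, map_zero, map_zero] at hn'
    have huu : u' = u := (sub_eq_zero.1 hn'.symm)
    subst huu
    exact ⟨(v, w), hq, Subtype.ext he⟩
  · rintro ⟨⟨v, w⟩, hq, rfl⟩
    refine ⟨_, ⟨(u, v, w), ⟨?_, hq⟩, rfl⟩, rfl⟩
    simp [O]

/-! ### The real Lie group structure of the fibres -/

/-- `(z, y) ↦ (y₁ - τ y₂, z - u y₂)`. -/
def fibreLin {d : ℕ} (τ : SiegelSpace d) (u : Fin d → ℂ) :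
    (ℂ × (Idx d → ℝ)) ≃L[ℝ] ((Fin d → ℂ) × ℂ) :=
  LinearEquiv.toContinuousLinearEquiv
  { toFun := fun q => (colMap τ q.2, q.1 - u ⬝ᵥ (fun i => (q.2 (Sum.inr i) : ℂ)))
    map_add' := fun p q => by
      refine Prod.ext (map_add _ _ _) ?_
      simp only [dotProduct, Prod.fst_add, Prod.snd_add, Pi.add_apply, Complex.ofReal_add, mul_add,
        Finset.sum_add_distrib]
      ring
    map_smul' := fun c q => by
      refine Prod.ext (colMap_smul τ c _) ?_
      simp only [dotProduct, Prod.smul_fst, Prod.smul_snd, Pi.smul_apply, smul_eq_mul,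
        Complex.ofReal_mul, Complex.real_smul, mul_sub, Finset.mul_sum, RingHom.id_apply]
      congr 1
      exact Finset.sum_congr rfl fun i _ => by ring
    invFun := fun q => (q.2 + u ⬝ᵥ (fun i => ((colEquiv τ).symm q.1 (Sum.inr i) : ℂ)),
      (colEquiv τ).symm q.1)
    left_inv := fun q => by
      have : (colEquiv τ).symm (colMap τ q.2) = q.2 := (colEquiv τ).symm_apply_apply q.2
      simp [this]
    right_inv := fun q => by
      have : colMap τ ((colEquiv τ).symm q.1) = q.1 := (colEquiv τ).apply_symm_apply q.1
      simp [this] }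

theorem fibreLin_apply {d : ℕ} (τ : SiegelSpace d) (u : Fin d → ℂ) (z : ℂ) (y : Idx d → ℝ) :
    fibreLin τ u (z, y) = (colMap τ y, z - u ⬝ᵥ (fun i => (y (Sum.inr i) : ℂ))) := rfl

theorem fibreLin_mem_iff {d : ℕ} (τ : SiegelSpace d) (u : Fin d → ℂ) (z : ℂ) (y : Idx d → ℝ) :
    fibreLin τ u (z, y) ∈ extLatA τ u ↔
      z ∈ AddSubgroup.zmultiples (2 * Real.pi * Complex.I : ℂ) ∧ y ∈ intLattice d := by
  rw [fibreLin_apply]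
  constructor
  · rintro ⟨k, m, h⟩
    obtain ⟨h1, h2⟩ := Prod.ext_iff.1 h
    have hy := colMap_injective τ h1
    subst hy
    refine ⟨AddSubgroup.mem_zmultiples_iff.2 ⟨k, ?_⟩, m, rfl⟩
    have h3 : z = 2 * Real.pi * Complex.I * k := by
      simpa [castHom] using h2
    rw [h3, zsmul_eq_mul, mul_comm]
  · rintro ⟨hz, m, rfl⟩
    obtain ⟨k, rfl⟩ := AddSubgroup.mem_zmultiples_iff.1 hz
    refine ⟨k, m, Prod.ext rfl ?_⟩
    simp [castHom, mul_comm]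

/-- The domain of the uniformisation of the fibres. -/
abbrev FibreModel (d : ℕ) := (ℂ ⧸ AddSubgroup.zmultiples (2 * Real.pi * Complex.I : ℂ)) ×
  ((Idx d → ℝ) ⧸ intLattice d)

/-- The quotient map onto `FibreModel d`. -/
def modelMk (d : ℕ) : (ℂ × (Idx d → ℝ)) →+ FibreModel d :=
  (QuotientAddGroup.mk' _).prodMap (QuotientAddGroup.mk' _)

theorem modelMk_surjective (d : ℕ) : Function.Surjective (modelMk d) :=
  (QuotientAddGroup.mk'_surjective _).prodMap (QuotientAddGroup.mk'_surjective _)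

theorem isOpenQuotientMap_modelMk (d : ℕ) : IsOpenQuotientMap (modelMk d) :=
  QuotientAddGroup.isOpenQuotientMap_mk.prodMap QuotientAddGroup.isOpenQuotientMap_mk

/-- The homomorphism from the universal cover onto the fibre. -/
def coverHom {d : ℕ} (τ : SiegelSpace d) {b : TorusB τ} (u : Fin d → ℂ)
    (hu : QuotientAddGroup.mk u = b) : (ℂ × (Idx d → ℝ)) →+ Extn τ b :=
  (extHom u hu).comp (fibreLin τ u).toLinearEquiv.toAddEquiv.toAddMonoidHom

theorem coverHom_eq_zero_iff {d : ℕ} (τ : SiegelSpace d) {b : TorusB τ} (u : Fin d → ℂ)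
    (hu : QuotientAddGroup.mk u = b) (q : ℂ × (Idx d → ℝ)) :
    coverHom τ u hu q = 0 ↔ modelMk d q = 0 := by
  refine (extHom_eq_zero_iff u hu _).trans ((fibreLin_mem_iff τ u q.1 q.2).trans ?_)
  rw [Prod.ext_iff]
  exact and_congr (QuotientAddGroup.eq_zero_iff _).symm (QuotientAddGroup.eq_zero_iff _).symm

theorem coverHom_surjective {d : ℕ} (τ : SiegelSpace d) {b : TorusB τ} (u : Fin d → ℂ)
    (hu : QuotientAddGroup.mk u = b) : Function.Surjective (coverHom τ u hu) :=
  (extMk_surjective u hu).comp (fibreLin τ u).surjective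

theorem coverHom_eq_iff {d : ℕ} (τ : SiegelSpace d) {b : TorusB τ} (u : Fin d → ℂ)
    (hu : QuotientAddGroup.mk u = b) (p q : ℂ × (Idx d → ℝ)) :
    coverHom τ u hu p = coverHom τ u hu q ↔ modelMk d p = modelMk d q := by
  rw [← sub_eq_zero, ← map_sub, coverHom_eq_zero_iff, map_sub, sub_eq_zero]

theorem isOpenQuotientMap_coverHom {d : ℕ} (τ : SiegelSpace d) {b : TorusB τ} (u : Fin d → ℂ)
    (hu : QuotientAddGroup.mk u = b) : IsOpenQuotientMap (coverHom τ u hu) :=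
  ⟨coverHom_surjective τ u hu, (continuous_extMk u hu).comp (fibreLin τ u).continuous,
    (isOpenMap_extMk u hu).comp (fibreLin τ u).toHomeomorph.isOpenMap⟩

/-- The uniformisation of the fibre over the class of `u`. -/
theorem exists_fibreIso {d : ℕ} (τ : SiegelSpace d) {b : TorusB τ} (u : Fin d → ℂ)
    (hu : QuotientAddGroup.mk u = b) :
    ∃ Φ : FibreModel d ≃ₜ+ Extn τ b, ∀ q, Φ (modelMk d q) = coverHom τ u hu q := by
  choose s hs using modelMk_surjective d
  have hval : ∀ q, coverHom τ u hu (s (modelMk d q)) = coverHom τ u hu q := fun q =>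
    (coverHom_eq_iff τ u hu _ _).2 (hs _)
  let φ : FibreModel d →+ Extn τ b := AddMonoidHom.mk' (fun Q => coverHom τ u hu (s Q)) (by
    intro P Q
    rw [← map_add, coverHom_eq_iff, map_add, hs, hs, hs])
  have hφ : Function.Bijective φ := by
    constructor
    · intro P Q h
      have := (coverHom_eq_iff τ u hu _ _).1 h
      rwa [hs, hs] at this
    · intro e
      obtain ⟨q, rfl⟩ := coverHom_surjective τ u hu e
      exact ⟨modelMk d q, hval q⟩
  have hcomp : φ ∘ modelMk d = coverHom τ u hu := funext hval
  have hcont : Continuous φ := by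
    -- The section `s` is not continuous; continuity and openness are both inherited from the two
    -- open quotient maps out of the universal cover.
    rw [(isOpenQuotientMap_modelMk d).isQuotientMap.continuous_iff, hcomp]
    exact (isOpenQuotientMap_coverHom τ u hu).continuous
  have hopen : IsOpenMap φ := by
    intro V hV
    have : φ '' V = coverHom τ u hu '' (modelMk d ⁻¹' V) := by
      rw [← hcomp, Set.image_comp, Set.image_preimage_eq _ (modelMk_surjective d)]
    rw [this]
    exact (isOpenQuotientMap_coverHom τ u hu).isOpenMap _
      (hV.preimage (isOpenQuotientMap_modelMk d).continuous)
  let e := AddEquiv.ofBijective φ hφ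
  exact ⟨{ e with
    continuous_toFun := hcont
    continuous_invFun := (e.toEquiv.toHomeomorphOfContinuousOpen hcont hopen).symm.continuous },
    hval⟩

theorem coverHom_val {d : ℕ} (τ : SiegelSpace d) {b : TorusB τ} (x y : Idx d → ℝ) (z : ℂ)
    (hu : QuotientAddGroup.mk (rowMap τ x) = b) :
    (coverHom τ (rowMap τ x) hu (2 * Real.pi * Complex.I * z, y)).1 =
      pmk ((⟨x, y, z⟩ : Heis d) • baseMHS τ) :=
  extMk_val x y z hu

theorem coverHom_eq_extPt {d : ℕ} (τ : SiegelSpace d) (x y : Idx d → ℝ) (z : ℂ) :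
    coverHom τ (b := toB τ x) (rowMap τ x) rfl (2 * Real.pi * Complex.I * z, y) =
      extPt τ x y z := by
  refine Subtype.ext ((coverHom_val τ x y z rfl).trans ?_)
  rw [extPt]
  congr 2
  simp [Heis.mul_def, rowElt]

/-! ### The Ribet section -/

theorem realMat_add_transpose {d : ℕ} (f : Matrix (Idx d) (Idx d) ℤ) (x : Idx d → ℝ) :
    realMat (f + fᵀ) *ᵥ x = realMat f *ᵥ x + (realMat f)ᵀ *ᵥ x := by
  rw [← add_mulVec]
  congr 1
  ext i j; simp

theorem dotProduct_realMat_add_transpose {d : ℕ} (f : Matrix (Idx d) (Idx d) ℤ) (x y : Idx d → ℝ) :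
    x ⬝ᵥ (realMat (f + fᵀ) *ᵥ y) = x ⬝ᵥ (realMat f *ᵥ y) + y ⬝ᵥ (realMat f *ᵥ x) := by
  rw [realMat_add_transpose, dotProduct_add, dotProduct_mulVec x _ y, dotProduct_mulVec x _ y,
    vecMul_transpose, dotProduct_comm (realMat f *ᵥ x)]

theorem castHom_dotProduct {d : ℕ} (m n : Idx d → ℤ) :
    castHom d m ⬝ᵥ castHom d n = ((m ⬝ᵥ n : ℤ) : ℝ) := by
  simp [castHom, dotProduct]

/-- The Ribet section in the trivialisation given by a representative `u`. -/
def ribetLift {d : ℕ} {τ : SiegelSpace d} (α : TorusHom τ) (u : Fin d → ℂ) : (Fin d → ℂ) × ℂ :=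
  (α.matC *ᵥ u, ribetW α.matZ u)

/-- The factor πi in `ribetW_rowMap` becomes 2πi because a = f + fᵗ gives x a xᵗ = 2 x f xᵗ. -/
theorem ribetLift_rowMap {d : ℕ} {τ : SiegelSpace d} (α : TorusHom τ)
    (f : Matrix (Idx d) (Idx d) ℤ) (hα : α.matZ = f + fᵀ) (x : Idx d → ℝ) :
    ribetLift α (rowMap τ x) = fibreLin τ (rowMap τ x)
      (2 * Real.pi * Complex.I * ((x ⬝ᵥ (realMat f *ᵥ x) : ℝ) : ℂ), realMat α.matZ *ᵥ x) := by
  have hs : α.matZᵀ = α.matZ := by rw [hα, transpose_add, transpose_transpose, add_comm]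
  rw [ribetLift, fibreLin_apply, α.comm_real, ribetW_rowMap α hs]
  have h : x ⬝ᵥ (realMat α.matZ *ᵥ x) = 2 * (x ⬝ᵥ (realMat f *ᵥ x)) := by
    rw [hα, dotProduct_realMat_add_transpose]; ring
  rw [h]
  refine Prod.ext rfl ?_
  simp only
  push_cast
  ring

theorem extMk_ribetLift_val {d : ℕ} {τ : SiegelSpace d} (α : TorusHom τ)
    (f : Matrix (Idx d) (Idx d) ℤ) (hα : α.matZ = f + fᵀ) (x : Idx d → ℝ) {b : TorusB τ}
    (hu : QuotientAddGroup.mk (rowMap τ x) = b) :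
    (extMk (rowMap τ x) hu (ribetLift α (rowMap τ x))).1 =
      pmk ((⟨x, realMat α.matZ *ᵥ x, ((x ⬝ᵥ (realMat f *ᵥ x) : ℝ) : ℂ)⟩ : Heis d) • baseMHS τ) := by
  rw [ribetLift_rowMap α f hα]
  exact coverHom_val τ x _ _ hu

/-- A change of representative is a translation of x by an integral vector, realised by an integral
group element. -/
theorem extMk_ribetLift_congr {d : ℕ} {τ : SiegelSpace d} (α : TorusHom τ)
    (f : Matrix (Idx d) (Idx d) ℤ) (hα : α.matZ = f + fᵀ) {b : TorusB τ} (u u' : Fin d → ℂ)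
    (hu : QuotientAddGroup.mk u = b) (hu' : QuotientAddGroup.mk u' = b) :
    extMk u hu (ribetLift α u) = extMk u' hu' (ribetLift α u') := by
  obtain ⟨x, rfl⟩ := exists_rowMap τ u
  obtain ⟨_, ⟨n, rfl⟩, hn⟩ := (QuotientAddGroup.eq).1 (hu.trans hu'.symm)
  have e : u' = rowMap τ (castHom d n + x) := by rw [map_add, hn]; abel
  subst e
  refine Subtype.ext ?_
  rw [extMk_ribetLift_val α f hα, extMk_ribetLift_val α f hα, eq_comm]
  -- The integral element has the same shape (n, a n, n f nᵗ) as the section. Using f rather than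
  -- a/2 makes the last entry visibly an integer.
  refine (pmk_eq_iff _ _).2 ⟨_, ⟨n, α.matZ *ᵥ n, n ⬝ᵥ (f *ᵥ n), rfl⟩, ?_⟩
  rw [smul_smul, Heis.mul_def]
  congr 1
  refine Heis.ext rfl ?_ ?_
  · simp only [castHom_mulVec, mulVec_add]
  · simp only
    have h : ((n ⬝ᵥ (f *ᵥ n) : ℤ) : ℝ) + x ⬝ᵥ (realMat f *ᵥ x) +
        castHom d n ⬝ᵥ (realMat α.matZ *ᵥ x) =
        (castHom d n + x) ⬝ᵥ (realMat f *ᵥ (castHom d n + x)) := by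
      rw [hα, dotProduct_realMat_add_transpose, mulVec_add, add_dotProduct, dotProduct_add,
        dotProduct_add, ← castHom_dotProduct, castHom_mulVec]
      ring
    rw [← h]
    push_cast
    rfl

/-- The Ribet section. -/
def ribetSection {d : ℕ} {τ : SiegelSpace d} (α : TorusHom τ) (b : TorusB τ) : Extn τ b :=
  extMk (Quotient.out b) (Quotient.out_eq' b) (ribetLift α (Quotient.out b))

theorem ribetSection_eq {d : ℕ} {τ : SiegelSpace d} (α : TorusHom τ)
    (f : Matrix (Idx d) (Idx d) ℤ) (hα : α.matZ = f + fᵀ) {b : TorusB τ} (u : Fin d → ℂ)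
    (hu : QuotientAddGroup.mk u = b) : ribetSection α b = extMk u hu (ribetLift α u) :=
  extMk_ribetLift_congr α f hα _ _ _ _

theorem ribetLift_zero {d : ℕ} {τ : SiegelSpace d} (α : TorusHom τ) : ribetLift α 0 = 0 := by
  refine Prod.ext (mulVec_zero α.matC) ?_
  simp [ribetLift, ribetW]

theorem isRibetSection_ribetSection {d : ℕ} {τ : SiegelSpace d} (α : TorusHom τ)
    (f : Matrix (Idx d) (Idx d) ℤ) (hα : α.matZ = f + fᵀ) :
    IsRibetSection α (ribetSection α) where
  holomorphic u₀ := ⟨Set.univ, isOpen_univ, Set.mem_univ _, fun u => α.matC *ᵥ u, ribetW α.matZ,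
    (LinearMap.toContinuousLinearMap (Matrix.mulVecLin α.matC)).differentiable.differentiableOn,
    (ribetW_differentiable α.matZ).differentiableOn,
    fun u _ => ribetSection_eq α f hα u rfl⟩
  graph b := by
    induction b using QuotientAddGroup.induction_on with
    | H u =>
    rw [ribetSection_eq α f hα u rfl]
    exact projA_pmk τ u _ _
  origin := by
    rw [ribetSection_eq α f hα (b := 0) 0 rfl, ribetLift_zero, extMk_zero]

theorem ribetSection_toB {d : ℕ} {τ : SiegelSpace d} (α : TorusHom τ)
    (f : Matrix (Idx d) (Idx d) ℤ) (hα : α.matZ = f + fᵀ) (x : Idx d → ℝ) :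
    ribetSection α (toB τ x) = coverHom τ (b := toB τ x) (rowMap τ x) rfl
      (2 * Real.pi * Complex.I * ((x ⬝ᵥ (realMat f *ᵥ x) : ℝ) : ℂ), realMat α.matZ *ᵥ x) := by
  rw [ribetSection_eq α f hα (b := toB τ x) (rowMap τ x) rfl, ribetLift_rowMap α f hα]
  rfl

theorem toB_eq_zero_iff {d : ℕ} (τ : SiegelSpace d) (x : Idx d → ℝ) :
    toB τ x = 0 ↔ ∃ m, x = castHom d m := by
  rw [toB, QuotientAddGroup.eq_zero_iff]
  constructor
  · rintro ⟨_, ⟨m, rfl⟩, h⟩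
    exact ⟨m, (rowMap_injective τ h).symm⟩
  · rintro ⟨m, rfl⟩
    exact ⟨_, ⟨m, rfl⟩, rfl⟩

/-- The Ribet section takes torsion values at torsion points. -/
theorem sq_nsmul_ribetSection {d : ℕ} {τ : SiegelSpace d} (α : TorusHom τ)
    (f : Matrix (Idx d) (Idx d) ℤ) (hα : α.matZ = f + fᵀ) (x : Idx d → ℝ) (n : ℕ)
    (hn : n • toB τ x = 0) : n ^ 2 • ribetSection α (toB τ x) = 0 := by
  have h : toB τ (n • x) = 0 := by
    rw [← hn, toB, toB, map_nsmul]; rfl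
  obtain ⟨m, hm⟩ := (toB_eq_zero_iff τ _).1 h
  have hm' : (n : ℝ) • x = castHom d m := by rw [← hm, Nat.cast_smul_eq_nsmul]
  rw [ribetSection_toB α f hα, ← map_nsmul]
  refine (coverHom_eq_zero_iff τ (b := toB τ x) (rowMap τ x) rfl _).2 ?_
  refine Prod.ext ((QuotientAddGroup.eq_zero_iff _).2 ?_) ((QuotientAddGroup.eq_zero_iff _).2 ?_)
  -- With n x = m integral, n² x f xᵗ = m f mᵗ: the quadratic term requires the square of n.
  · refine AddSubgroup.mem_zmultiples_iff.2 ⟨m ⬝ᵥ (f *ᵥ m), ?_⟩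
    have e : (n : ℝ) ^ 2 * (x ⬝ᵥ (realMat f *ᵥ x)) = ((m ⬝ᵥ (f *ᵥ m) : ℤ) : ℝ) := by
      rw [← castHom_dotProduct, castHom_mulVec, ← hm', mulVec_smul, smul_dotProduct,
        dotProduct_smul, smul_eq_mul, smul_eq_mul]
      ring
    have e' := congrArg (fun r : ℝ => (r : ℂ)) e
    push_cast at e'
    change (m ⬝ᵥ (f *ᵥ m)) • (2 * Real.pi * Complex.I : ℂ) =
      n ^ 2 • (2 * Real.pi * Complex.I * ((x ⬝ᵥ (realMat f *ᵥ x) : ℝ) : ℂ))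
    simp only [zsmul_eq_mul, nsmul_eq_mul]
    push_cast
    linear_combination (-2 * Real.pi * Complex.I) * e'
  · refine ⟨n • (α.matZ *ᵥ m), ?_⟩
    rw [map_nsmul, castHom_mulVec, ← hm', mulVec_smul, Nat.cast_smul_eq_nsmul, smul_smul, sq]
    rfl

/-! ### Uniqueness -/

/-- When two points of the fibre lie over the same point of A_τ, their difference lies in ℂ^×; the
term u·m₂ accounts for the lattice vector separating the chosen lifts. -/
theorem sub_sub_mem_extLatA {d : ℕ} {τ : SiegelSpace d} (u v v' : Fin d → ℂ) (w w' : ℂ)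
    (m : Idx d → ℤ) (h : v' - v = colMap τ (castHom d m)) :
    (v', w') - (v, w) - (0, w' - w + u ⬝ᵥ (fun i => (m (Sum.inr i) : ℂ))) ∈ extLatA τ u := by
  refine ⟨0, m, Prod.ext ?_ ?_⟩
  · simpa using h
  · simp

theorem extHom_zero_prod_eq_iff {d : ℕ} {τ : SiegelSpace d} {b : TorusB τ} (u : Fin d → ℂ)
    (hu : QuotientAddGroup.mk u = b) (δ δ' : ℂ) :
    extHom u hu (0, δ) = extHom u hu (0, δ') ↔ Complex.exp δ = Complex.exp δ' := by
  rw [← sub_eq_zero, ← map_sub, extHom_eq_zero_iff, Complex.exp_eq_exp_iff_exists_int]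
  constructor
  · rintro ⟨k, m, h⟩
    obtain ⟨h1, h2⟩ := Prod.ext_iff.1 h
    have hm : castHom d m = 0 := by
      rw [← map_eq_zero_iff _ (colMap_injective τ)]; exact h1.symm.trans (sub_self _)
    have hm0 : m = 0 := castHom_eq_zero_of_norm_lt m (by rw [hm]; simp)
    subst hm0
    refine ⟨k, ?_⟩
    have h3 : δ - δ' = 2 * Real.pi * Complex.I * k := by simpa [dotProduct] using h2
    linear_combination h3
  · rintro ⟨k, hk⟩
    refine ⟨k, 0, Prod.ext (by simp) ?_⟩
    simp only [Prod.mk_sub_mk, hk]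
    simp [dotProduct]
    ring

/-- Changing u by a lattice vector n shifts w by 2πi n₁·v, which vanishes at v = 0. Thus ℂ^× embeds
in the fibre independently of the representative. -/
theorem extHom_zero_prod_congr {d : ℕ} {τ : SiegelSpace d} {b : TorusB τ} (u u' : Fin d → ℂ)
    (hu : QuotientAddGroup.mk u = b) (hu' : QuotientAddGroup.mk u' = b) (δ : ℂ) :
    extHom u hu (0, δ) = extHom u' hu' (0, δ) := by
  obtain ⟨_, ⟨n, rfl⟩, hn⟩ := (QuotientAddGroup.eq).1 (hu.trans hu'.symm)
  refine Subtype.ext (Eq.symm ((pmk_eq_iff _ _).2 ⟨_, ⟨n, 0, 0, rfl⟩, ?_⟩))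
  rw [smul_ofCoords]
  have e : u' = u + rowMap τ (castHom d n) := by rw [hn]; abel
  simp only [map_zero, add_zero, ← e]
  congr 1
  simp [dotProduct]

/-- An entire function that is periodic with respect to the lattice of `B_τ` is constant. -/
theorem apply_eq_apply_of_periodic {d : ℕ} (τ : SiegelSpace d) (h : (Fin d → ℂ) → ℂ)
    (hd : Differentiable ℂ h) (hp : ∀ u u', (QuotientAddGroup.mk u : TorusB τ) =
      QuotientAddGroup.mk u' → h u = h u') (u u' : Fin d → ℂ) : h u = h u' := by
  refine hd.apply_eq_apply_of_bounded ?_ u u'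
  have hc : IsCompact (h '' (rowEquiv τ '' Set.Icc 0 1)) :=
    (isCompact_Icc.image (rowEquiv τ).continuous).image hd.continuous
  refine hc.isBounded.subset ?_
  rintro _ ⟨u, rfl⟩
  obtain ⟨x, rfl⟩ := exists_rowMap τ u
  -- Fractional parts move the point into the compact image of the unit cube, so the function is
  -- bounded and Liouville applies.
  refine ⟨rowMap τ (fun i => Int.fract (x i)), ⟨_, ⟨fun i => Int.fract_nonneg _,
    fun i => (Int.fract_lt_one _).le⟩, rfl⟩, hp _ _ (QuotientAddGroup.eq.2 ?_)⟩
  refine ⟨_, ⟨fun i => ⌊x i⌋, rfl⟩, ?_⟩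
  rw [neg_add_eq_sub, ← map_sub]
  congr 1
  ext i
  exact (Int.self_sub_fract _).symm

/-- A continuous function with values in the lattice of `A_τ` is locally constant. -/
theorem eventually_eq_of_mem_latA {d : ℕ} (τ : SiegelSpace d) {U : Set (Fin d → ℂ)}
    (hU : IsOpen U) {u₀ : Fin d → ℂ} (hu₀ : u₀ ∈ U) (l : (Fin d → ℂ) → (Fin d → ℂ))
    (hl : ContinuousOn l U) (hmem : ∀ u ∈ U, ∃ m, l u = colMap τ (castHom d m)) :
    ∃ m, ∀ᶠ u in 𝓝 u₀, l u = colMap τ (castHom d m) := by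
  obtain ⟨m, hm⟩ := hmem u₀ hu₀
  refine ⟨m, ?_⟩
  have hcont : ContinuousAt (fun u => (colEquiv τ).symm (l u)) u₀ :=
    (colEquiv τ).symm.continuous.continuousAt.comp (hl.continuousAt (hU.mem_nhds hu₀))
  filter_upwards [hU.mem_nhds hu₀, Metric.continuousAt_iff'.1 hcont 1 one_pos] with u hu hd
  obtain ⟨m', hm'⟩ := hmem u hu
  rw [hm, hm', ← colEquiv_apply, ← colEquiv_apply, ContinuousLinearEquiv.symm_apply_apply,
    ContinuousLinearEquiv.symm_apply_apply, dist_eq_norm, ← map_sub] at hd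
  rw [hm', sub_eq_zero.1 (castHom_eq_zero_of_norm_lt _ hd)]

/-- The difference with `ribetSection α` is a point δ(u) of ℂ/2πiℤ. The lifts δ(u) are chosen
arbitrarily, so only exp δ is meaningful: it is entire, periodic, and 1 at the origin. -/
theorem IsRibetSection.eq_ribetSection {d : ℕ} {τ : SiegelSpace d} {α : TorusHom τ}
    (f : Matrix (Idx d) (Idx d) ℤ) (hα : α.matZ = f + fᵀ) {r : ∀ b : TorusB τ, Extn τ b}
    (hr : IsRibetSection α r) : r = ribetSection α := by
  have hlift : ∀ (u v' : Fin d → ℂ) (w' : ℂ), r (QuotientAddGroup.mk u) = extMk u rfl (v', w') →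
      ∃ m : Idx d → ℤ, v' - α.matC *ᵥ u = colMap τ (castHom d m) := by
    intro u v' w' h
    have h1 := hr.graph (QuotientAddGroup.mk u)
    rw [h] at h1
    have h2 : (QuotientAddGroup.mk v' : TorusA τ) = QuotientAddGroup.mk (α.matC *ᵥ u) :=
      (projA_pmk τ u v' w').symm.trans h1
    obtain ⟨_, ⟨m, rfl⟩, hm⟩ := QuotientAddGroup.eq.1 h2.symm
    exact ⟨m, by rw [hm]; abel⟩
  have hdiff : ∀ (u v' : Fin d → ℂ) (w' : ℂ) (m : Idx d → ℤ),
      r (QuotientAddGroup.mk u) = extMk u rfl (v', w') →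
      v' - α.matC *ᵥ u = colMap τ (castHom d m) →
      r (QuotientAddGroup.mk u) - ribetSection α (QuotientAddGroup.mk u) =
        extHom u rfl (0, w' - ribetW α.matZ u + u ⬝ᵥ (fun i => (m (Sum.inr i) : ℂ))) := by
    intro u v' w' m h hm
    have h1 : r (QuotientAddGroup.mk u) = extHom u rfl (v', w') := h
    have h2 : ribetSection α (QuotientAddGroup.mk u) =
      extHom u rfl (α.matC *ᵥ u, ribetW α.matZ u) := ribetSection_eq α f hα u rfl
    rw [h1, h2, ← sub_eq_zero, ← map_sub, ← map_sub, extHom_eq_zero_iff]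
    exact sub_sub_mem_extLatA u _ _ _ _ m hm
  have hex : ∀ u : Fin d → ℂ, ∃ δ : ℂ,
      r (QuotientAddGroup.mk u) - ribetSection α (QuotientAddGroup.mk u) = extHom u rfl (0, δ) := by
    intro u
    obtain ⟨⟨v', w'⟩, h⟩ := extMk_surjective (τ := τ) u rfl (r (QuotientAddGroup.mk u))
    obtain ⟨m, hm⟩ := hlift u v' w' h.symm
    exact ⟨_, hdiff u v' w' m h.symm hm⟩
  choose δ hδ using hex
  have hdif : Differentiable ℂ (fun u => Complex.exp (δ u)) := by
    intro u₀
    obtain ⟨U, hU, hu₀, v, w, hv, hw, hrU⟩ := hr.holomorphic u₀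
    have hlin : Differentiable ℂ (fun u : Fin d → ℂ => α.matC *ᵥ u) :=
      (LinearMap.toContinuousLinearMap (Matrix.mulVecLin α.matC)).differentiable
    -- The lifts v and α agree modulo the lattice of A_τ, so near u₀ their difference is one fixed
    -- lattice vector. With m fixed, the formula for the difference of sections is holomorphic in u.
    obtain ⟨m, hm⟩ := eventually_eq_of_mem_latA τ hU hu₀ (fun u => v u - α.matC *ᵥ u)
      (hv.continuousOn.sub hlin.continuous.continuousOn) (fun u hu => hlift u _ _ (hrU u hu))
    have heq : (fun u => Complex.exp (δ u)) =ᶠ[𝓝 u₀] fun u => Complex.exp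
        (w u - ribetW α.matZ u + u ⬝ᵥ (fun i => (m (Sum.inr i) : ℂ))) := by
      filter_upwards [hm, hU.mem_nhds hu₀] with u hmu hu
      rw [← extHom_zero_prod_eq_iff (τ := τ) u rfl, ← hδ]
      exact hdiff u _ _ m (hrU u hu) hmu
    refine DifferentiableAt.congr_of_eventuallyEq ?_ heq
    refine (((hw.differentiableAt (hU.mem_nhds hu₀)).sub
      (ribetW_differentiable _ u₀)).add ?_).cexp
    unfold dotProduct
    fun_prop
  have hper : ∀ u u' : Fin d → ℂ, (QuotientAddGroup.mk u : TorusB τ) = QuotientAddGroup.mk u' →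
      Complex.exp (δ u) = Complex.exp (δ u') := by
    intro u u' huu
    -- Stated for a variable base point, so that the fibre over the common class can be described by
    -- either representative.
    have key : ∀ b (hu : QuotientAddGroup.mk u = b),
        r b - ribetSection α b = extHom u hu (0, δ u) := by
      rintro _ rfl
      exact hδ u
    rw [← extHom_zero_prod_eq_iff (τ := τ) u' rfl, ← hδ u', key _ huu]
    exact extHom_zero_prod_congr _ _ _ _ _
  have h0 : Complex.exp (δ 0) = Complex.exp 0 := by
    rw [← extHom_zero_prod_eq_iff (τ := τ) 0 rfl, ← hδ 0]
    refine Eq.trans ?_ (map_zero (extHom (τ := τ) 0 rfl)).symm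
    exact sub_eq_zero.2 (hr.origin.trans (isRibetSection_ribetSection α f hα).origin.symm)
  funext b
  induction b using QuotientAddGroup.induction_on with
  | H u =>
  have h1 := (apply_eq_apply_of_periodic τ _ hdif hper u 0).trans h0
  rw [← sub_eq_zero, hδ u, (extHom_zero_prod_eq_iff (τ := τ) u rfl _ _).2 h1]
  exact map_zero (extHom (τ := τ) u rfl)

end

end RibetMSV

theorem mainTheorem7 (d : ℕ) (hd : 1 ≤ d) (τ₀ : SiegelSpace d) (f fdual : TorusHom τ₀)
    (hdual : IsDual f fdual) (τ : SiegelSpace d)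
    (hτ : τ ∈ siegelOrbit τ₀ (f - fdual).matZ) :
    (Function.Bijective (fun p : Heis d => p • baseMHS τ) ∧
      Function.Bijective (orbitMap τ) ∧
      (∀ x : Idx d → ℝ, orbitMap τ (hmk (rowElt x)) = unitSection τ (toB τ x)) ∧
      orbitMap τ '' Set.range (fun x : Idx d → ℝ => hmk (rowElt x)) =
        Set.range (unitSection τ)) ∧
    ∃ α : TorusHom τ, α.matZ = (f - fdual).matZ ∧
      ∃ r : ∀ b : TorusB τ, Extn τ b, IsRibetSection α r ∧
        (∀ r' : ∀ b : TorusB τ, Extn τ b, IsRibetSection α r' → r' = r) ∧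
        ∀ x : Idx d → ℝ,
          (∃ Φ : ((ℂ ⧸ AddSubgroup.zmultiples (2 * Real.pi * Complex.I : ℂ)) ×
              ((Idx d → ℝ) ⧸ intLattice d)) ≃ₜ+ Extn τ (toB τ x),
            IsRealLieIso Φ ∧
            (∀ (z : ℂ) (y : Idx d → ℝ),
              Φ (QuotientAddGroup.mk (2 * Real.pi * Complex.I * z), QuotientAddGroup.mk y) =
                extPt τ x y z) ∧
            Φ (QuotientAddGroup.mk (2 * Real.pi * Complex.I *
                  ((x ⬝ᵥ (f.matZ.map (Int.cast : ℤ → ℝ) *ᵥ x) : ℝ) : ℂ)),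
                QuotientAddGroup.mk ((f - fdual).matZ.map (Int.cast : ℤ → ℝ) *ᵥ x)) =
              r (toB τ x)) ∧
          ∀ n : ℕ, 0 < n → addOrderOf (toB τ x) = n → n ^ 2 • r (toB τ x) = 0 := by
  -- Duality enters only here: it makes the matrix of α symmetric, and equal to twice the symmetric
  -- part of that of f.
  have hsub : (f - fdual).matZ = f.matZ + f.matZᵀ := by
    change f.matZ - fdual.matZ = _
    rw [hdual.matZ_eq, sub_neg_eq_add]
  refine ⟨⟨bijective_smul_baseMHS τ, bijective_orbitMap τ, orbitMap_rowElt τ,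
    image_orbitMap_rowElt τ⟩, ?_⟩
  let α : TorusHom τ := torusHomOfMat τ (f - fdual).matZ
    (colLin_mulVec_eq_zero_of_mem_siegelOrbit (f - fdual) hτ)
  have hα : α.matZ = f.matZ + f.matZᵀ := hsub
  refine ⟨α, rfl, ribetSection α, isRibetSection_ribetSection α f.matZ hα,
    fun r' hr' => hr'.eq_ribetSection f.matZ hα, fun x => ⟨?_, ?_⟩⟩
  · obtain ⟨Φ, hΦ⟩ := exists_fibreIso τ (b := toB τ x) (rowMap τ x) rfl
    refine ⟨Φ, ⟨fibreLin τ (rowMap τ x), fun z y => hΦ (z, y)⟩, fun z y => ?_, ?_⟩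
    · exact (hΦ (2 * Real.pi * Complex.I * z, y)).trans (coverHom_eq_extPt τ x y z)
    · exact (hΦ (_, _)).trans (ribetSection_toB α f.matZ hα x).symm
  · intro n _ hn
    exact sq_nsmul_ribetSection α f.matZ hα x n (hn ▸ addOrderOf_nsmul_eq_zero _)
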